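/- Let $M$ be a smooth (finite-dimensional, Hausdorff) manifold, let $E\to M$ be a smooth real vector bundle of finite rank, and let $[\cdot,\cdot]$ be an $\mathbb R$-bilinear bracket on the $C^\infty(M)$-module $\mathrm{Sec}(E)$ of smooth sections of $E$ (not assumed skew-symmetric). Assume the Jacobi identity $$[[X,Y],Z]=[X,[Y,Z]]-[Y,[X,Z]]\qquad (X,Y,Z\in \mathrm{Sec}(E)),$$ and assume that the bracket is a quasi-derivation in both arguments: for each $X$, each of the operators $D=[X,\cdot]$ and $D=[\cdot,X]$ has the property that for every $f\in C^\infty(M)$ there is $h\in C^\infty(M)$ with $D(fY)-fD(Y)=hY$ for all $Y\in\mathrm{Sec}(E)$. (a) If $\mathrm{rank}(E)>1$, then there is a smooth vector bundle morphism $a:E\to TM$ over the identity of $M$ such that $a([X,Y])=[a(X),a(Y)]_{vf}$ (the Lie bracket of vector fields) and $$[fX,gY]=fg[X,Y]+f\,a(X)(g)\,Y-g\,a(Y)(f)\,X$$ for all $X,Y\in \mathrm{Sec}(E)$ and $f,g\in C^\infty(M)$. Moreover, $[X,Y](p)=-[Y,X](p)$ for all $X,Y\in\mathrm{Sec}(E)$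 at every point $p\in M$ where the linear map $a_p:E_p\to T_pM$ is non-zero. (b) If $\mathrm{rank}(E)=1$, then the bracket is skew-symmetric and defines a local Lie algebra structure on $\mathrm{Sec}(E)$: it is a Lie bracket, $\mathrm{supp}[X,Y]\subset\mathrm{supp}X\cap\mathrm{supp}Y$ for all $X,Y$, and it is a first-order differential operator in each argument. Moreover, it is locally equivalent to a Jacobi bracket: every point of $M$ has an open neighbourhood $U$ with a smooth nowhere vanishing section $e$ of $E|_U$, a smooth bivector field $\Lambda$ on $U$ and a smooth vector field $\Gamma$ on $U$ such that the bracket $$\{f,g\}=\Lambda(df,dg)+f\,\Gamma(g)-g\,\Gamma(f)$$ on $C^\infty(U)$ satisfies the Jacobi identity, and for all $X,Y\in\mathrm{Sec}(E)$ with $X|_U=fe$ and $Y|_U=ge$, where $f,g\in C^\infty(U)$, one has $[X,Y]|_U=\{f,g\}\,e$. -/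

import Mathlib

set_option maxSynthPendingDepth 3

open Bundle Set
open scoped Manifold ContDiff Topology

noncomputable section

section Algebra

variable (R : Type*) {E : Type*} [CommRing R] [AddCommGroup E] [Module R E]

/-- A linear operator `D` on an `A`-module is a quasi-`A`-derivation if its commutator with the
multiplication by any `f : A` is again the multiplication by some element of `A`. -/
def IsQuasiDerivation (A : Type*) [CommRing A] [Module A E] (D : E →ₗ[R] E) : Prop :=
  ∀ f : A, ∃ h : A, ∀ X : E, D (f • X) - f • D X = h • X

/-- A linear operator `D` on an `A`-module is a differential operator of order at most one if
`[[D, f], g] = 0` for all multiplication operators `f`, `g`. -/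
def IsFirstOrderDiffOp (A : Type*) [CommRing A] [Module A E] (D : E →ₗ[R] E) : Prop :=
  ∀ (f g : A) (X : E),
    (D (f • (g • X)) - f • D (g • X)) - g • (D (f • X) - f • D X) = 0

variable {R}

/-- The Jacobi identity in the form `[[X,Y],Z] = [X,[Y,Z]] - [Y,[X,Z]]`, which makes sense for
brackets that are not necessarily skew-symmetric. -/
def SatisfiesJacobi (br : E →ₗ[R] E →ₗ[R] E) : Prop :=
  ∀ X Y Z : E, br (br X Y) Z = br X (br Y Z) - br Y (br X Z)

end Algebra

section Manifold

variable {B : Type*} [NormedAddCommGroup B] [NormedSpace ℝ B]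
  {H : Type*} [TopologicalSpace H] {I : ModelWithCorners ℝ B H}
  {M : Type*} [TopologicalSpace M] [ChartedSpace H M]
  {F : Type*} [NormedAddCommGroup F] [NormedSpace ℝ F]
  {V : M → Type*} [TopologicalSpace (TotalSpace F V)]
  [∀ x, AddCommGroup (V x)] [∀ x, Module ℝ (V x)] [∀ x, TopologicalSpace (V x)]
  [FiberBundle F V] [VectorBundle ℝ F V]

/-- Pointwise multiplication of a smooth section by a smooth function. -/
instance smoothSectionSMul : SMul C^∞⟮I, M; ℝ⟯ Cₛ^∞⟮I; F, V⟯ where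
  smul f X := ⟨fun x => f x • X x, f.contMDiff.smul_section X.contMDiff⟩

@[simp]
theorem smoothSection_smul_apply (f : C^∞⟮I, M; ℝ⟯) (X : Cₛ^∞⟮I; F, V⟯) (x : M) :
    (f • X) x = f x • X x := rfl

/-- The smooth sections of a vector bundle as a module over the ring of smooth functions. -/
instance smoothSectionModule : Module C^∞⟮I, M; ℝ⟯ Cₛ^∞⟮I; F, V⟯ where
  one_smul X := by ext x; exact one_smul ℝ (X x)
  mul_smul f g X := by ext x; exact mul_smul (f x) (g x) (X x)
  smul_zero f := by ext x; exact smul_zero (f x)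
  smul_add f X Y := by ext x; exact smul_add (f x) (X x) (Y x)
  add_smul f g X := by ext x; exact add_smul (f x) (g x) (X x)
  zero_smul X := by ext x; exact zero_smul ℝ (X x)

/-- The support of a section: the closure of the set of points where it does not vanish. -/
def sectionSupport (X : Cₛ^∞⟮I; F, V⟯) : Set M := closure {x | X x ≠ 0}

/-- A local Lie algebra structure on the sections of a vector bundle: a Lie bracket which does not
increase supports and is a (first order) differential operator in each argument. -/
structure IsLocalLieAlgebra
    (br : Cₛ^∞⟮I; F, V⟯ →ₗ[ℝ] Cₛ^∞⟮I; F, V⟯ →ₗ[ℝ] Cₛ^∞⟮I; F, V⟯) : Prop where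
  alternating : ∀ X, br X X = 0
  jacobi : SatisfiesJacobi br
  support_subset : ∀ X Y, sectionSupport (br X Y) ⊆ sectionSupport X ∩ sectionSupport Y
  diffOp_right : ∀ X, IsFirstOrderDiffOp ℝ C^∞⟮I, M; ℝ⟯ (br X)
  diffOp_left : ∀ Y, IsFirstOrderDiffOp ℝ C^∞⟮I, M; ℝ⟯ (br.flip Y)

variable (I F V) in
/-- A vector bundle morphism `a : E → TM` over the identity of `M`: a smooth map of total spaces
which is linear on the fibers. -/
structure AnchorMorphism [IsManifold I ∞ M] where
  toFun : ∀ x : M, V x →ₗ[ℝ] TangentSpace I x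
  smooth : ContMDiff (I.prod 𝓘(ℝ, F)) I.tangent ∞
    (fun v : TotalSpace F V => (⟨v.proj, toFun v.proj v.2⟩ : TangentBundle I M))

/-- The derivative `v(f)` of a function along a tangent vector at `x`. -/
def dirDeriv (f : M → ℝ) (x : M) (v : TangentSpace I x) : ℝ :=
  (mfderiv I 𝓘(ℝ, ℝ) f x : TangentSpace I x →L[ℝ] ℝ) v

variable (I) in
/-- A field of bilinear forms on the cotangent spaces, i.e. of contravariant 2-tensors. -/
abbrev TwoTensorField (M : Type*) [TopologicalSpace M] [ChartedSpace H M] :=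
  ∀ x : M, (TangentSpace I x →L[ℝ] ℝ) →L[ℝ] (TangentSpace I x →L[ℝ] ℝ) →L[ℝ] ℝ

/-- The operation `(f, g) ↦ Λ(df, dg) + f Γ(g) - g Γ(f)`. -/
def jacobiOp (L : TwoTensorField I M) (G : ∀ x : M, TangentSpace I x) (f g : M → ℝ) (x : M) : ℝ :=
  L x (mfderiv I 𝓘(ℝ, ℝ) f x : TangentSpace I x →L[ℝ] ℝ)
      (mfderiv I 𝓘(ℝ, ℝ) g x : TangentSpace I x →L[ℝ] ℝ)
    + f x * dirDeriv g x (G x) - g x * dirDeriv f x (G x)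

/-- On the open set `U`, `L` is a smooth bivector field, `G` is a smooth vector field, and
`(f, g) ↦ L(df, dg) + f G(g) - g G(f)` is a Jacobi bracket on `C^∞(U)`, that is, it satisfies the
Jacobi identity (bilinearity and skew-symmetry are automatic). -/
structure IsJacobiBracketOn [IsManifold I ∞ M] (U : Set M)
    (L : TwoTensorField I M) (G : ∀ x : M, TangentSpace I x) : Prop where
  smooth_bivector : ContMDiffOn I (I.prod 𝓘(ℝ, (B →L[ℝ] ℝ) →L[ℝ] (B →L[ℝ] ℝ) →L[ℝ] ℝ)) ∞
    (fun x => TotalSpace.mk' ((B →L[ℝ] ℝ) →L[ℝ] (B →L[ℝ] ℝ) →L[ℝ] ℝ)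
      (E := fun x : M =>
        (TangentSpace I x →L[ℝ] ℝ) →L[ℝ] (TangentSpace I x →L[ℝ] ℝ) →L[ℝ] ℝ) x (L x)) U
  alternating : ∀ x ∈ U, ∀ α : TangentSpace I x →L[ℝ] ℝ, L x α α = 0
  smooth_vectorField : ContMDiffOn I I.tangent ∞ (fun x => (⟨x, G x⟩ : TangentBundle I M)) U
  jacobi : ∀ f g h : M → ℝ, ContMDiffOn I 𝓘(ℝ, ℝ) ∞ f U → ContMDiffOn I 𝓘(ℝ, ℝ) ∞ g U →
    ContMDiffOn I 𝓘(ℝ, ℝ) ∞ h U → ∀ x ∈ U,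
      jacobiOp L G (jacobiOp L G f g) h x
        = jacobiOp L G f (jacobiOp L G g h) x - jacobiOp L G g (jacobiOp L G f h) x

/-- The bracket is locally equivalent to a Jacobi bracket: near every point there is a smooth
nowhere vanishing local section `e` over an open set `U` such that, under the identification
`f ↦ f e` of `C^∞(U)` with the sections over `U` (for a bundle of rank one), the bracket becomes
a Jacobi bracket on `C^∞(U)`. -/
def IsLocallyJacobi [IsManifold I ∞ M]
    (br : Cₛ^∞⟮I; F, V⟯ →ₗ[ℝ] Cₛ^∞⟮I; F, V⟯ →ₗ[ℝ] Cₛ^∞⟮I; F, V⟯) : Prop :=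
  ∀ p : M, ∃ (U : Set M) (e : ∀ x : M, V x)
    (L : TwoTensorField I M) (G : ∀ x : M, TangentSpace I x),
    IsOpen U ∧ p ∈ U ∧
    ContMDiffOn I (I.prod 𝓘(ℝ, F)) ∞ (fun x => TotalSpace.mk' F x (e x)) U ∧
    (∀ x ∈ U, e x ≠ 0) ∧
    IsJacobiBracketOn U L G ∧
    ∀ (X Y : Cₛ^∞⟮I; F, V⟯) (f g : M → ℝ),
      ContMDiffOn I 𝓘(ℝ, ℝ) ∞ f U → ContMDiffOn I 𝓘(ℝ, ℝ) ∞ g U →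
      (∀ x ∈ U, X x = f x • e x) → (∀ x ∈ U, Y x = g x • e x) →
      ∀ x ∈ U, br X Y x = jacobiOp L G f g x • e x

end Manifold

end

/-! Write `[X, fY] = f[X,Y] + a_X(f)Y` and `[fX, Y] = f[X,Y] + b_Y(f)X`. Since the module is
faithful, `a_X` and `b_Y` are derivations of the function ring, and the Jacobi identity gives
`a_[X,Y] = [a_X, a_Y]`.

The central point is `a + b = 0` (`add_eq_zero`), which is pure algebra over a reduced ring
containing 1/2. The right side of the Jacobi identity is antisymmetric in `X, Y`, so `[X,Y] + [Y,X]`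
brackets to zero with everything from the left. Replacing `X` by `fX` gives an identity whose
coefficients force a power of `a_Y(f) + b_Y(f)` to vanish. What remains is `a_Z(f)([X,Y] + [Y,X]) =
0`, that is, skew-symmetry wherever the symbol is non-zero.

Expanding `[fX, gY]` in two ways gives `(a_{fX}(g) - f a_X(g))Y = (b_{gY}(f) - g b_Y(f))X`. In rank
greater than one, `Y` can be taken independent of `X` at a point, so both coefficients vanish: `a`
is tensorial in `X`, hence is a bundle morphism once derivations are identified with vector fields
through Hadamard's lemma.

In rank one, `S(X,Y) = [X,Y] + [Y,X]` is bilinear over functions because `a + b = 0`. If `s =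
S(X,Y)` is non-zero at `p`, then near `p` both `X` and `Y` are multiples of `s`, while `S(s,s) =
2[s,s] = 0`; hence `S = 0`. For a non-vanishing local section `e`, the defect `a_{fe}(g) - f a_e(g)`
is a skew biderivation, so it is a bivector field `Λ`. With `Γ = a_e`, the bracket becomes the
Jacobi bracket of `Λ` and `Γ`. -/

noncomputable section

/-! ### Algebra of symbols over a commutative ring -/

section LeibnizBrackets

variable {R A S : Type*} [CommRing R] [CommRing A] [AddCommGroup S] [Module R S] [Module A S]

/-- `a` and `b` are the symbols of a bracket which is a quasi-derivation in both arguments: they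
measure the failure of the bracket to be `A`-linear in the second and in the first argument. -/
structure IsBracketSymbol (br : S →ₗ[R] S →ₗ[R] S) (a b : S → A → A) : Prop where
  right : ∀ X f Y, br X (f • Y) = f • br X Y + a X f • Y
  left : ∀ X f Y, br (f • X) Y = f • br X Y + b Y f • X

namespace IsBracketSymbol

variable {br : S →ₗ[R] S →ₗ[R] S} {a b : S → A → A}

theorem exists_of_isQuasiDerivation (hright : ∀ X, IsQuasiDerivation R A (br X))
    (hleft : ∀ Y, IsQuasiDerivation R A (br.flip Y)) :
    ∃ a b : S → A → A, IsBracketSymbol br a b := by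
  choose a ha using hright
  choose b hb using hleft
  refine ⟨a, b, fun X f Y => ?_, fun X f Y => ?_⟩
  · rw [← ha X f Y]; abel
  · rw [← hb Y f X]; simp

theorem flip (h : IsBracketSymbol br a b) : IsBracketSymbol br.flip b a :=
  ⟨fun X f Y => by simpa using h.left Y f X, fun X f Y => by simpa using h.right Y f X⟩

/-- The two orders of expanding `[fX, gY]` must agree. This controls how far the symbol is from
being linear in the section: independent `X, Y` kill the defect, while `X = Y` makes it skew. -/
theorem smul_left_sub_smul (h : IsBracketSymbol br a b) (X Y : S) (f g : A) :
    (a (f • X) g - f * a X g) • Y = (b (g • Y) f - g * b Y f) • X := by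
  have h1 := h.right (f • X) g Y
  rw [h.left, h.left, h.right] at h1
  linear_combination (norm := module) -h1

variable [FaithfulSMul A S]

theorem eq_of_forall_smul_eq {f g : A} (h : ∀ X : S, f • X = g • X) : f = g :=
  FaithfulSMul.eq_of_smul_eq_smul h

theorem mul (h : IsBracketSymbol br a b) (X : S) (f g : A) :
    a X (f * g) = f * a X g + g * a X f := by
  refine eq_of_forall_smul_eq (S := S) fun Y => ?_
  have h1 := h.right X (f * g) Y
  rw [mul_smul, h.right, h.right] at h1
  linear_combination (norm := module) -h1

theorem add (h : IsBracketSymbol br a b) (X : S) (f g : A) : a X (f + g) = a X f + a X g := by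
  refine eq_of_forall_smul_eq (S := S) fun Y => ?_
  have h1 := h.right X (f + g) Y
  rw [add_smul, map_add, h.right, h.right] at h1
  linear_combination (norm := module) -h1

theorem add_left (h : IsBracketSymbol br a b) (X Y : S) (f : A) :
    a (X + Y) f = a X f + a Y f := by
  refine eq_of_forall_smul_eq (S := S) fun Z => ?_
  have h1 := h.right (X + Y) f Z
  rw [map_add, LinearMap.add_apply, LinearMap.add_apply, h.right, h.right] at h1
  linear_combination (norm := module) -h1

theorem map_zero_left (h : IsBracketSymbol br a b) (f : A) : a 0 f = 0 := by
  have h1 := h.add_left 0 0 f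
  rwa [add_zero, left_eq_add] at h1

theorem map_smul [Algebra R A] [IsScalarTower R A S] (h : IsBracketSymbol br a b) (X : S) (r : R)
    (f : A) : a X (r • f) = r • a X f := by
  refine eq_of_forall_smul_eq (S := S) fun Y => ?_
  have h1 := h.right X (r • f) Y
  rw [smul_assoc, _root_.map_smul, h.right, smul_add, smul_assoc] at h1
  rw [smul_assoc]
  exact (add_left_cancel h1).symm

theorem map_smul_left [Algebra R A] [IsScalarTower R A S] (h : IsBracketSymbol br a b) (X : S)
    (r : R) (f : A) : a (r • X) f = r • a X f := by
  refine eq_of_forall_smul_eq (S := S) fun Y => ?_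
  have h1 := h.right (r • X) f Y
  rw [LinearMap.map_smul br, LinearMap.smul_apply, LinearMap.smul_apply, h.right, smul_add,
    smul_comm r f] at h1
  rw [smul_assoc]
  exact (add_left_cancel h1).symm

/-- Compare the coefficients of `Z` in the Jacobi identity for `X, Y, fZ`. -/
theorem bracket (h : IsBracketSymbol br a b) (hjac : SatisfiesJacobi br) (X Y : S) (f : A) :
    a (br X Y) f = a X (a Y f) - a Y (a X f) := by
  refine eq_of_forall_smul_eq (S := S) fun Z => ?_
  have h1 := hjac X Y (f • Z)
  simp only [h.right, map_add] at h1
  rw [hjac X Y Z] at h1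
  linear_combination (norm := module) h1

variable (h : IsBracketSymbol br a b) (hjac : SatisfiesJacobi br)
include h hjac

/-- By antisymmetry of the right side of the Jacobi identity, `[[X,Y] + [Y,X], Z] = 0`. Put `fX` for
`X` and expand; the source of all vanishing results on `a + b`. -/
theorem smul_add_bracket_swap_smul (X Y Z : S) (f : A) :
    b Z f • (br X Y + br Y X) + (a Y f + b Y f) • br X Z + b Z (a Y f + b Y f) • X = 0 := by
  have skew (X Y Z : S) : br (br X Y) Z + br (br Y X) Z = 0 := by
    rw [hjac X Y Z, hjac Y X Z]; abel
  have h1 := skew (f • X) Y Z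
  simp only [h.right, h.left, map_add, LinearMap.add_apply] at h1
  rw [h.flip.add]
  linear_combination (norm := module) h1 - f • skew X Y Z

variable [IsReduced A]

/-- With `c = a_Y + b_Y`, subtract `2f` times the previous identity for `f` from the one for `f²`.
The derivation rule leaves only `2 b_Z(f) c(f) X = 0`; polarization then treats two different
functions. -/
theorem mul_add_eq_zero [Invertible (2 : A)] (Y Z : S) (f g : A) :
    b Z f * (a Y g + b Y g) = 0 := by
  have diag (f : A) : b Z f * (a Y f + b Y f) = 0 := by
    refine eq_of_forall_smul_eq (S := S) fun X => ?_
    have h1 := h.smul_add_bracket_swap_smul hjac X Y Z (f * f)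
    have h2 := h.smul_add_bracket_swap_smul hjac X Y Z f
    simp only [h.mul, h.flip.mul, h.flip.add] at h1 h2
    have h3 : (2 : A) • ((2 : A) • ((b Z f * (a Y f + b Y f)) • X)) = 0 := by
      linear_combination (norm := module) (2 : A) • h1 - (4 * f) • h2
    have h4 := congrArg (fun W => (⅟2 : A) • (⅟2 : A) • W) h3
    simpa [← mul_smul] using h4
  have polar : b Z f * (a Y g + b Y g) + b Z g * (a Y f + b Y f) = 0 := by
    have h1 := diag (f + g)
    rw [h.add, h.flip.add, h.flip.add] at h1
    linear_combination h1 - diag f - diag g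
  -- By polarity the square of `b_Z(f) c(g)` is `-(b_Z(f) c(f)) (b_Z(g) c(g))`, which is zero.
  refine (pow_eq_zero_iff (two_ne_zero)).1 ?_
  linear_combination b Z f * (a Y g + b Y g) * polar - diag f * b Z g * (a Y g + b Y g)

/-- The two symbols of a bracket satisfying the Jacobi identity are opposite. -/
theorem add_eq_zero [Invertible (2 : A)] (Y : S) (f : A) : a Y f + b Y f = 0 := by
  have hz := h.mul_add_eq_zero hjac
  -- Multiplying the identity by `c = a_Y(f) + b_Y(f)` kills the terms with `b_Z(f)` and `b_Z(c)`,
  -- leaving `c²[X,Z] = 0`.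
  have sq (X Z : S) : ((a Y f + b Y f) * (a Y f + b Y f)) • br X Z = 0 := by
    have h1 := h.smul_add_bracket_swap_smul hjac X Y Z f
    have h2 := hz Y Z f f
    have h5 : (a Y f + b Y f) * b Z (a Y f + b Y f) = 0 := by
      rw [mul_comm]; exact hz Y Z (a Y f + b Y f) f
    have h6 := congrArg (fun W => (a Y f + b Y f) • W) h1
    simp only [smul_add, ← mul_smul, h5, zero_smul, add_zero, smul_zero] at h6
    rw [mul_comm (a Y f + b Y f) (b Z f), h2, zero_smul, zero_smul, zero_add, zero_add] at h6
    exact h6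
  have cube (g : A) : ((a Y f + b Y f) * (a Y f + b Y f)) * a Y g = 0 := by
    refine eq_of_forall_smul_eq (S := S) fun Z => ?_
    have h1 := sq Y (g • Z)
    rw [h.right] at h1
    linear_combination (norm := module) h1 - g • sq Y Z
  -- `c³ = c² a_Y(f) + c (c b_Y(f))`, and both summands vanish.
  refine (pow_eq_zero_iff (three_ne_zero)).1 ?_
  linear_combination cube f + (a Y f + b Y f) * hz Y Y f f

theorem smul_add_bracket_swap [Invertible (2 : A)] (X Y Z : S) (f : A) :
    a Z f • (br X Y + br Y X) = 0 := by
  have h1 := h.smul_add_bracket_swap_smul hjac X Y Z f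
  have h2 : b Z (0 : A) = 0 := by
    have := h.flip.add Z 0 0
    rwa [add_zero, left_eq_add] at this
  rw [h.add_eq_zero hjac, h2, zero_smul, zero_smul, add_zero, add_zero] at h1
  linear_combination (norm := module) (h.add_eq_zero hjac Z f) • (br X Y + br Y X) - h1

end IsBracketSymbol

end LeibnizBrackets

/-! ### Hadamard's lemma -/

section Hadamard

variable {E F : Type} [NormedAddCommGroup E] [NormedSpace ℝ E] [FiniteDimensional ℝ E]
  [NormedAddCommGroup F] [NormedSpace ℝ F]

theorem hasFDerivAt_parametric_integral {K : E × ℝ → F} (hK : ContDiff ℝ ∞ K) (x : E) :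
    HasFDerivAt (fun x => ∫ t in (0 : ℝ)..1, K (x, t))
      (∫ t in (0 : ℝ)..1, (fderiv ℝ K (x, t)).comp (ContinuousLinearMap.inl ℝ E ℝ)) x := by
  have hK' : Continuous (fun p : E × ℝ => (fderiv ℝ K p).comp (ContinuousLinearMap.inl ℝ E ℝ)) :=
    (hK.continuous_fderiv (by simp)).clm_comp continuous_const
  have hc (x : E) : Continuous fun t : ℝ => K (x, t) := hK.continuous.comp (by fun_prop)
  have hc' (x : E) : Continuous fun t : ℝ =>
      (fderiv ℝ K (x, t)).comp (ContinuousLinearMap.inl ℝ E ℝ) :=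
    hK'.comp (by fun_prop : Continuous fun t : ℝ => (x, t))
  obtain ⟨C, hC⟩ := ((isCompact_closedBall x 1).prod (isCompact_Icc (a := (0 : ℝ)) (b := 1))
    ).exists_bound_of_continuousOn hK'.continuousOn
  refine intervalIntegral.hasFDerivAt_integral_of_dominated_of_fderiv_le
    (F' := fun x t => (fderiv ℝ K (x, t)).comp (ContinuousLinearMap.inl ℝ E ℝ))
    (bound := fun _ => C) (Metric.closedBall_mem_nhds x one_pos)
    (.of_forall fun y => (hc y).aestronglyMeasurable) ((hc x).intervalIntegrable _ _)
    (hc' x).aestronglyMeasurable (.of_forall fun t ht y hy => ?_) intervalIntegrable_const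
    (.of_forall fun t _ y _ => ?_)
  · rw [uIoc_of_le zero_le_one] at ht
    exact hC (y, t) ⟨hy, ht.1.le, ht.2⟩
  · exact ((hK.differentiable (by simp) (y, t)).hasFDerivAt).comp y (hasFDerivAt_prodMk_left y t)

/-- Induction on the order: the derivative is again a parametric integral, with values in `E →L[ℝ]
F`. The induction therefore varies `F`, which is why the spaces share one universe. -/
theorem contDiff_parametric_integral {K : E × ℝ → F} (hK : ContDiff ℝ ∞ K) :
    ContDiff ℝ ∞ fun x => ∫ t in (0 : ℝ)..1, K (x, t) := by
  refine contDiff_infty.2 fun m => ?_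
  induction m generalizing F with
  | zero =>
    exact contDiff_zero.2 (continuous_iff_continuousAt.2 fun x =>
      (hasFDerivAt_parametric_integral hK x).continuousAt)
  | succ m ih =>
    rw [Nat.cast_succ, contDiff_succ_iff_fderiv]
    refine ⟨fun x => (hasFDerivAt_parametric_integral hK x).differentiableAt, by simp, ?_⟩
    rw [funext fun x => (hasFDerivAt_parametric_integral hK x).fderiv]
    refine ih (K := fun p => (fderiv ℝ K p).comp (ContinuousLinearMap.inl ℝ E ℝ)) ?_
    exact (hK.fderiv_right (by simp)).clm_comp contDiff_const

/-- Hadamard's lemma: a smooth function is its value at a point plus a smooth family of linear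
forms applied to the displacement from that point. -/
theorem ContDiff.exists_hadamard {φ : E → ℝ} (hφ : ContDiff ℝ ∞ φ) (c : E) :
    ∃ G : E → E →L[ℝ] ℝ, ContDiff ℝ ∞ G ∧ G c = fderiv ℝ φ c ∧
      ∀ y, φ y = φ c + G y (y - c) := by
  -- `G y` is the average of the derivative of `φ` along the segment from `c` to `y`.
  have hK : ContDiff ℝ ∞ fun p : E × ℝ => fderiv ℝ φ (c + p.2 • (p.1 - c)) :=
    (hφ.fderiv_right (m := ∞) (by simp)).comp (by fun_prop)
  refine ⟨_, contDiff_parametric_integral hK, by simp, fun y => ?_⟩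
  have hd (t : ℝ) : HasDerivAt (fun t : ℝ => φ (c + t • (y - c)))
      (fderiv ℝ φ (c + t • (y - c)) (y - c)) t := by
    refine (hφ.differentiable (by simp) _).hasFDerivAt.comp_hasDerivAt t ?_
    simpa using ((hasDerivAt_id t).smul_const (y - c)).const_add c
  have hc : Continuous fun t : ℝ => fderiv ℝ φ (c + t • (y - c)) :=
    hK.continuous.comp (by fun_prop : Continuous fun t : ℝ => (y, t))
  have h1 := intervalIntegral.integral_eq_sub_of_hasDerivAt (a := 0) (b := 1) (fun t _ => hd t)
    ((hc.clm_apply continuous_const).intervalIntegrable _ _)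
  rw [ContinuousLinearMap.intervalIntegral_apply (hc.intervalIntegrable _ _), h1]
  simp

end Hadamard

/-! ### Extending local functions and sections by cutoffs -/

section Extension

variable {n : ℕ} {M : Type*} [TopologicalSpace M] [T2Space M]
  [ChartedSpace (EuclideanSpace ℝ (Fin n)) M] [IsManifold (𝓡 n) ∞ M]

theorem exists_smooth_cutoff {x : M} {s : Set M} (hs : s ∈ 𝓝 x) :
    ∃ χ : C^∞⟮𝓡 n, M; ℝ⟯, χ =ᶠ[𝓝 x] 1 ∧ tsupport χ ⊆ s := by
  obtain ⟨χ, -, hχ⟩ := (SmoothBumpFunction.nhds_basis_tsupport (I := 𝓡 n) x).mem_iff.1 hs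
  exact ⟨⟨χ, χ.contMDiff⟩, χ.eventuallyEq_one, hχ⟩

theorem exists_smooth_eventuallyEq {g : M → ℝ} {U : Set M} {x : M} (hU : IsOpen U) (hx : x ∈ U)
    (hg : ContMDiffOn (𝓡 n) 𝓘(ℝ, ℝ) ∞ g U) : ∃ f : C^∞⟮𝓡 n, M; ℝ⟯, f =ᶠ[𝓝 x] g := by
  obtain ⟨χ, hχ, hs⟩ := exists_smooth_cutoff (n := n) (hU.mem_nhds hx)
  refine ⟨⟨fun y => χ y • g y, contMDiff_of_tsupport fun y hy => ?_⟩, ?_⟩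
  · have hy' : y ∈ U := hs (closure_mono (Function.support_smul_subset_left _ _) hy)
    exact χ.contMDiff.contMDiffAt.smul ((hg y hy').contMDiffAt (hU.mem_nhds hy'))
  · filter_upwards [hχ] with y hy
    show χ y • g y = g y
    rw [hy, Pi.one_apply, one_smul]

variable {F : Type*} [NormedAddCommGroup F] [NormedSpace ℝ F]
  {V : M → Type*} [TopologicalSpace (TotalSpace F V)]
  [∀ x, AddCommGroup (V x)] [∀ x, Module ℝ (V x)] [∀ x, TopologicalSpace (V x)]
  [FiberBundle F V] [VectorBundle ℝ F V]

theorem exists_section_eventuallyEq {s : ∀ x, V x} {U : Set M} {x : M} (hU : IsOpen U)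
    (hx : x ∈ U)
    (hs : ContMDiffOn (𝓡 n) ((𝓡 n).prod 𝓘(ℝ, F)) ∞ (fun y => TotalSpace.mk' F y (s y)) U) :
    ∃ X : Cₛ^∞⟮𝓡 n; F, V⟯, ∀ᶠ y in 𝓝 x, X y = s y := by
  obtain ⟨χ, hχ, hχU⟩ := exists_smooth_cutoff (n := n) (hU.mem_nhds hx)
  refine ⟨⟨fun y => χ y • s y,
    χ.contMDiff.contMDiffOn.smul_section_of_tsupport hU hχU hs⟩, ?_⟩
  filter_upwards [hχ] with y hy
  show χ y • s y = s y
  rw [hy, Pi.one_apply, one_smul]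

/-- Every vector in a fiber is the value of a global smooth section. -/
theorem exists_section_apply_eq [ContMDiffVectorBundle ∞ F V (𝓡 n)] (x : M) (v : V x) :
    ∃ X : Cₛ^∞⟮𝓡 n; F, V⟯, X x = v := by
  set e := trivializationAt F V x
  have hx : x ∈ e.baseSet := FiberBundle.mem_baseSet_trivializationAt F V x
  obtain ⟨X, hX⟩ := exists_section_eventuallyEq (n := n) (s := fun y => e.symm y (e ⟨x, v⟩).2)
    e.open_baseSet hx (by
      rw [e.contMDiffOn_section_baseSet_iff]
      refine (contMDiffOn_const (c := (e ⟨x, v⟩).2)).congr fun y hy => ?_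
      rw [e.apply_mk_symm hy])
  exact ⟨X, by rw [hX.self_of_nhds]; exact e.symm_apply_apply_mk hx v⟩

end Extension

/-! ### Point derivations are tangent vectors -/

section PointDerivation

variable {n : ℕ} {M : Type*} [TopologicalSpace M]
  [ChartedSpace (EuclideanSpace ℝ (Fin n)) M]

/-- A linear form on smooth functions satisfying the Leibniz rule at the point `x`. -/
def IsPointDerivation (x : M) (D : C^∞⟮𝓡 n, M; ℝ⟯ →ₗ[ℝ] ℝ) : Prop :=
  ∀ f g : C^∞⟮𝓡 n, M; ℝ⟯, D (f * g) = f x * D g + g x * D f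

namespace IsPointDerivation

variable {x : M} {D : C^∞⟮𝓡 n, M; ℝ⟯ →ₗ[ℝ] ℝ}

theorem map_algebraMap (hD : IsPointDerivation x D) (c : ℝ) : D (algebraMap ℝ _ c) = 0 := by
  have h1 := hD 1 1
  have h2 : (1 : C^∞⟮𝓡 n, M; ℝ⟯) x = 1 := rfl
  rw [mul_one, h2] at h1
  rw [Algebra.algebraMap_eq_smul_one, map_smul, show D 1 = 0 by linarith, smul_zero]

/-- Locality: apply the Leibniz rule to `χ(f - g) = 0` with a cutoff `χ` equal to one at `x`. -/
theorem congr [T2Space M] [IsManifold (𝓡 n) ∞ M] (hD : IsPointDerivation x D)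
    {f g : C^∞⟮𝓡 n, M; ℝ⟯} (hfg : f =ᶠ[𝓝 x] g) : D f = D g := by
  obtain ⟨χ, hχ, hs⟩ := exists_smooth_cutoff (n := n) hfg
  have h0 : χ * (f - g) = 0 := by
    ext y
    show χ y * (f y - g y) = 0
    by_cases hy : y ∈ tsupport χ
    · rw [show f y = g y from hs hy, sub_self, mul_zero]
    · rw [image_eq_zero_of_notMem_tsupport hy, zero_mul]
  have h1 := hD χ (f - g)
  have h2 : (f - g) x = 0 := by
    show f x - g x = 0
    rw [hfg.self_of_nhds, sub_self]
  rw [h0, map_zero, h2, hχ.self_of_nhds, map_sub, Pi.one_apply] at h1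
  linarith

/-- Every point derivation is the derivative along a tangent vector. -/
theorem exists_eq_dirDeriv [T2Space M] [IsManifold (𝓡 n) ∞ M] (hD : IsPointDerivation x D) :
    ∃ w : TangentSpace (𝓡 n) x, ∀ f : C^∞⟮𝓡 n, M; ℝ⟯, D f = dirDeriv f x w := by
  set c := extChartAt (𝓡 n) x x with hc
  have hsrc : (chartAt (EuclideanSpace ℝ (Fin n)) x).source ∈ 𝓝 x := chart_source_mem_nhds _ x
  have hchart : ContMDiffOn (𝓡 n) 𝓘(ℝ, EuclideanSpace ℝ (Fin n)) ∞ (extChartAt (𝓡 n) x)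
    (chartAt (EuclideanSpace ℝ (Fin n)) x).source := contMDiffOn_extChartAt
  have hcoord (i : Fin n) : ∃ u : C^∞⟮𝓡 n, M; ℝ⟯,
      u =ᶠ[𝓝 x] fun y => extChartAt (𝓡 n) x y i :=
    exists_smooth_eventuallyEq (chartAt _ x).open_source (mem_chart_source _ x)
      ((EuclideanSpace.proj (𝕜 := ℝ) i).contMDiff.comp_contMDiffOn hchart)
  choose u hu using hcoord
  refine ⟨∑ i, D (u i) • EuclideanSpace.single i (1 : ℝ), fun f => ?_⟩
  -- Hadamard's lemma integrates along segments, so the coordinate expression of `f` is first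
  -- extended to the whole model space.
  obtain ⟨φ, hφ⟩ := exists_smooth_eventuallyEq (n := n) (x := c)
    (g := f ∘ (extChartAt (𝓡 n) x).symm) (isOpen_extChartAt_target x) (mem_extChartAt_target x)
    (f.contMDiff.comp_contMDiffOn (contMDiffOn_extChartAt_symm x))
  obtain ⟨G, hG, hGc, hGφ⟩ := φ.contMDiff.contDiff.exists_hadamard c
  have hg (i : Fin n) : ∃ g : C^∞⟮𝓡 n, M; ℝ⟯,
      g =ᶠ[𝓝 x] fun y => G (extChartAt (𝓡 n) x y) (EuclideanSpace.single i 1) :=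
    exists_smooth_eventuallyEq (chartAt _ x).open_source (mem_chart_source _ x)
      (((hG.clm_apply contDiff_const).contMDiff).comp_contMDiffOn hchart)
  choose g hg using hg
  -- Near `x`, `f = f(x) + ∑ gᵢ (uᵢ - cᵢ)` with `gᵢ(x)` the partial derivatives, so `D f = ∑ gᵢ(x)
  -- D(uᵢ)`.
  have hf : f =ᶠ[𝓝 x] (algebraMap ℝ C^∞⟮𝓡 n, M; ℝ⟯ (f x)
      + ∑ i, g i * (u i - algebraMap ℝ C^∞⟮𝓡 n, M; ℝ⟯ (c i)) : C^∞⟮𝓡 n, M; ℝ⟯) := by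
    have hpull := (continuousAt_extChartAt (I := 𝓡 n) x).eventually hφ
    filter_upwards [hpull, Filter.eventually_all.2 hu, Filter.eventually_all.2 hg, hsrc]
      with y hy huy hgy hys
    have hfy : f y = φ (extChartAt (𝓡 n) x y) := by
      rw [hy, Function.comp_apply, (extChartAt (𝓡 n) x).left_inv (by rwa [extChartAt_source])]
    have hfx : f x = φ c := by
      rw [hφ.self_of_nhds, Function.comp_apply, hc, extChartAt_to_inv]
    have hsum : extChartAt (𝓡 n) x y - c
        = ∑ i, (u i y - c i) • EuclideanSpace.single i (1 : ℝ) := by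
      ext j
      simp [huy, Finset.sum_apply, Pi.single_apply]
    rw [hfy, hGφ, hsum, map_sum, ← hfx]
    have hev (h : C^∞⟮𝓡 n, M; ℝ⟯) : h y = ContMDiffMap.evalRingHom y h := rfl
    rw [hev (_ + _), map_add, map_sum]
    congr 1
    refine Finset.sum_congr rfl fun i _ => ?_
    rw [map_smul, smul_eq_mul, mul_comm, ← hgy i]
    rfl
  have hfd : ∀ w, dirDeriv (I := 𝓡 n) f x w = fderiv ℝ φ c w := by
    intro w
    have hφd : HasFDerivAt (f ∘ (extChartAt (𝓡 n) x).symm) (fderiv ℝ φ c) c :=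
      (φ.contMDiff.contDiff.differentiable (by simp) c).hasFDerivAt.congr_of_eventuallyEq hφ.symm
    have hfd : HasMFDerivAt (𝓡 n) 𝓘(ℝ, ℝ) f x (fderiv ℝ φ c) :=
      ⟨f.contMDiff.continuous.continuousAt, hφd.hasFDerivWithinAt⟩
    exact DFunLike.congr_fun hfd.mfderiv w
  rw [hD.congr hf, map_add, hD.map_algebraMap, map_sum, zero_add, hfd, ← hGc]
  refine (Finset.sum_congr rfl fun i _ => ?_).trans (map_sum (G c) _ _).symm
  have hux : (u i - algebraMap ℝ C^∞⟮𝓡 n, M; ℝ⟯ (c i)) x = 0 := by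
    show u i x - c i = 0
    rw [(hu i).self_of_nhds, sub_self]
  rw [hD, hux, zero_mul, add_zero, map_sub, hD.map_algebraMap, sub_zero, map_smul,
    (hg i).self_of_nhds, smul_eq_mul, mul_comm]

end IsPointDerivation

end PointDerivation

/-! ### Tangent vectors tested against global functions -/

section TangentVectors

variable {n : ℕ} {M : Type*} [TopologicalSpace M]
  [ChartedSpace (EuclideanSpace ℝ (Fin n)) M]

theorem dirDeriv_congr {f g : M → ℝ} {x : M} (h : f =ᶠ[𝓝 x] g) (v : TangentSpace (𝓡 n) x) :
    dirDeriv (I := 𝓡 n) f x v = dirDeriv g x v := by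
  exact DFunLike.congr_fun (h.mfderiv_eq (I := 𝓡 n) (I' := 𝓘(ℝ, ℝ))) v

theorem dirDeriv_add {f : M → ℝ} {x : M} (v w : TangentSpace (𝓡 n) x) :
    dirDeriv f x (v + w) = dirDeriv f x v + dirDeriv f x w :=
  ContinuousLinearMap.map_add (mfderiv (𝓡 n) 𝓘(ℝ, ℝ) f x : TangentSpace (𝓡 n) x →L[ℝ] ℝ) v w

theorem dirDeriv_smul {f : M → ℝ} {x : M} (c : ℝ) (v : TangentSpace (𝓡 n) x) :
    dirDeriv f x (c • v) = c * dirDeriv f x v :=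
  ContinuousLinearMap.map_smul (mfderiv (𝓡 n) 𝓘(ℝ, ℝ) f x : TangentSpace (𝓡 n) x →L[ℝ] ℝ) c v

variable [IsManifold (𝓡 n) ∞ M]

/-- The tangent trivialization is the differential of the chart. This turns fibre coordinates into
derivatives of functions, which may be globally smooth. -/
theorem trivializationAt_tangent_apply {p x : M} {f : M → ℝ} {i : Fin n}
    (hx : x ∈ (chartAt (EuclideanSpace ℝ (Fin n)) p).source)
    (hf : f =ᶠ[𝓝 x] fun y => extChartAt (𝓡 n) p y i) (v : TangentSpace (𝓡 n) x) :
    ((trivializationAt (EuclideanSpace ℝ (Fin n)) (TangentSpace (𝓡 n)) p)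
      (⟨x, v⟩ : TangentBundle (𝓡 n) M)).2 i = dirDeriv f x v := by
  have : IsManifold (𝓡 n) 1 M := .of_le (n := ∞) (by simp)
  have hx' : x ∈ (trivializationAt (EuclideanSpace ℝ (Fin n)) (TangentSpace (𝓡 n)) p).baseSet := by
    simpa using hx
  have hd : MDifferentiableAt (𝓡 n) (𝓡 n) (extChartAt (𝓡 n) p) x := mdifferentiableAt_extChartAt hx
  have h1 := TangentBundle.continuousLinearMapAt_trivializationAt (I := 𝓡 n) hx
  have h2 : ((trivializationAt (EuclideanSpace ℝ (Fin n)) (TangentSpace (𝓡 n)) p)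
      (⟨x, v⟩ : TangentBundle (𝓡 n) M)).2 = mfderiv (𝓡 n) (𝓡 n) (extChartAt (𝓡 n) p) x v := by
    rw [← h1]
    exact (congrFun (Trivialization.coe_linearMapAt_of_mem (R := ℝ) _ hx') v).symm
  rw [h2, dirDeriv_congr hf]
  have h3 := (((EuclideanSpace.proj (𝕜 := ℝ) i :
    EuclideanSpace ℝ (Fin n) →L[ℝ] ℝ).hasMFDerivAt
    (x := extChartAt (𝓡 n) p x)).comp x hd.hasMFDerivAt).mfderiv
  exact (DFunLike.congr_fun h3 v).symm

variable [T2Space M]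

/-- The coordinate functions of a chart, extended to global smooth functions. -/
theorem exists_smooth_coordinates {p x : M}
    (hx : x ∈ (chartAt (EuclideanSpace ℝ (Fin n)) p).source) :
    ∃ u : Fin n → C^∞⟮𝓡 n, M; ℝ⟯, ∀ i, u i =ᶠ[𝓝 x] fun y => extChartAt (𝓡 n) p y i := by
  have hchart : ContMDiffOn (𝓡 n) 𝓘(ℝ, EuclideanSpace ℝ (Fin n)) ∞ (extChartAt (𝓡 n) p)
    (chartAt (EuclideanSpace ℝ (Fin n)) p).source := contMDiffOn_extChartAt
  exact Classical.axiomOfChoice fun i => exists_smooth_eventuallyEq (n := n)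
    (chartAt _ p).open_source hx
      ((EuclideanSpace.proj (𝕜 := ℝ) i).contMDiff.comp_contMDiffOn hchart)

/-- Tangent vectors are determined by the derivatives of global smooth functions along them. -/
theorem eq_of_forall_dirDeriv_eq {x : M} {v w : TangentSpace (𝓡 n) x}
    (h : ∀ f : C^∞⟮𝓡 n, M; ℝ⟯, dirDeriv f x v = dirDeriv f x w) : v = w := by
  obtain ⟨u, hu⟩ := exists_smooth_coordinates (n := n) (mem_chart_source _ x)
  set e := trivializationAt (EuclideanSpace ℝ (Fin n)) (TangentSpace (𝓡 n)) x
  have hx : x ∈ e.baseSet := mem_baseSet_trivializationAt _ _ x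
  have h1 : (e ⟨x, v⟩).2 = (e ⟨x, w⟩).2 := by
    ext i
    rw [trivializationAt_tangent_apply (mem_chart_source _ x) (hu i), h,
      trivializationAt_tangent_apply (mem_chart_source _ x) (hu i)]
  rw [← e.symm_apply_apply_mk hx v, h1, e.symm_apply_apply_mk hx w]

variable {E' H' N : Type*} [NormedAddCommGroup E'] [NormedSpace ℝ E'] [TopologicalSpace H']
  {J : ModelWithCorners ℝ E' H'} [TopologicalSpace N] [ChartedSpace H' N]

/-- A map to the tangent bundle is smooth if it is smooth on the base and the derivatives of all
smooth functions along it are smooth. -/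
theorem contMDiffAt_tangentBundle_of_dirDeriv {Φ : N → TangentBundle (𝓡 n) M} {y : N}
    (hbase : ContMDiffAt J (𝓡 n) ∞ (fun z => (Φ z).proj) y)
    (h : ∀ f : C^∞⟮𝓡 n, M; ℝ⟯,
      ContMDiffAt J 𝓘(ℝ, ℝ) ∞ (fun z => dirDeriv f (Φ z).proj (Φ z).2) y) :
    ContMDiffAt J (𝓡 n).tangent ∞ Φ y := by
  refine contMDiffAt_totalSpace.2 ⟨hbase, ?_⟩
  set p := (Φ y).proj
  obtain ⟨u, hu⟩ := exists_smooth_coordinates (n := n) (mem_chart_source _ p)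
  refine (EuclideanSpace.equiv (Fin n) ℝ).symm.toContinuousLinearMap.contMDiff.contMDiffAt.comp y
    (f := fun z => EuclideanSpace.equiv (Fin n) ℝ (trivializationAt (EuclideanSpace ℝ (Fin n))
      (TangentSpace (𝓡 n)) p (Φ z)).2) ?_
  refine contMDiffAt_pi_space.2 fun i => (h (u i)).congr_of_eventuallyEq ?_
  have h1 : ∀ᶠ q in 𝓝 p, q ∈ (chartAt (EuclideanSpace ℝ (Fin n)) p).source ∧
      u i =ᶠ[𝓝 q] fun y => extChartAt (𝓡 n) p y i :=
    (Filter.eventually_mem_set.2 (chart_source_mem_nhds _ p)).and (hu i).eventuallyEq_nhds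
  filter_upwards [hbase.continuousAt.eventually h1] with z hz
  exact trivializationAt_tangent_apply hz.1 hz.2 _

-- The argument of `IsBracketSymbol.bracket` for the Lie bracket of vector fields: subtract `f`
-- times the Leibniz identity for `X, Y, Z` from the one for `X, Y, fZ`, and cancel `Z`, chosen
-- non-zero at `x`.
open VectorField in
theorem dirDeriv_mlieBracket {X Y : Cₛ^∞⟮𝓡 n; EuclideanSpace ℝ (Fin n), TangentSpace (𝓡 n)⟯}
    {f Xf Yf : C^∞⟮𝓡 n, M; ℝ⟯} (hXf : ∀ y : M, Xf y = dirDeriv f y (X y))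
    (hYf : ∀ y : M, Yf y = dirDeriv f y (Y y)) (x : M) :
    dirDeriv f x (mlieBracket (𝓡 n) X Y x) = dirDeriv Yf x (X x) - dirDeriv Xf x (Y x) := by
  have hle (k : ℕ) : (k : ℕ∞ω) ≤ ∞ := by exact_mod_cast le_top
  have hmin (k : ℕ) : minSmoothness ℝ (k : ℕ∞ω) ≤ ∞ := by
    rw [minSmoothness_of_isRCLikeNormedField]; exact hle k
  have : IsManifold (𝓡 n) (minSmoothness ℝ 2) M := .of_le (n := ∞) (hmin 2)
  have : IsManifold (𝓡 n) (minSmoothness ℝ 3) M := .of_le (n := ∞) (hmin 3)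
  have : IsManifold (𝓡 n) ((3 : ℕ∞) + 1) M := .of_le (n := ∞) (by norm_cast)
  -- In dimension zero no non-zero `Z` exists, but both sides vanish.
  rcases subsingleton_or_nontrivial (EuclideanSpace ℝ (Fin n)) with hn | hn
  · have (w : TangentSpace (𝓡 n) x) : w = 0 := hn.elim (α := EuclideanSpace ℝ (Fin n)) w 0
    simp only [this (mlieBracket (𝓡 n) X Y x), this (X x), this (Y x), dirDeriv, map_zero]
    exact (sub_zero (0 : ℝ)).symm
  obtain ⟨z, hz⟩ := exists_ne (0 : EuclideanSpace ℝ (Fin n))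
  obtain ⟨Z, hZ⟩ := exists_section_apply_eq (n := n)
    (F := EuclideanSpace ℝ (Fin n)) (V := fun x : M => TangentSpace (𝓡 n) x) x z
  have hd (g : C^∞⟮𝓡 n, M; ℝ⟯) (y : M) : MDifferentiableAt (𝓡 n) 𝓘(ℝ, ℝ) g y :=
    g.contMDiff.mdifferentiable (by simp) y
  have hs (W : Cₛ^∞⟮𝓡 n; EuclideanSpace ℝ (Fin n), (TangentSpace (𝓡 n) : M → Type)⟯) (y : M) :
      MDifferentiableAt (𝓡 n) (𝓡 n).tangent (fun x => (⟨x, W x⟩ : TangentBundle (𝓡 n) M)) y :=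
    W.contMDiff.mdifferentiable (by simp) y
  have hb (W : Cₛ^∞⟮𝓡 n; EuclideanSpace ℝ (Fin n), (TangentSpace (𝓡 n) : M → Type)⟯) (y : M) :
      MDifferentiableAt (𝓡 n) (𝓡 n).tangent
        (fun x => (⟨x, mlieBracket (𝓡 n) W Z x⟩ : TangentBundle (𝓡 n) M)) y :=
    ((W.contMDiff.contMDiffAt.of_le (hle 3)).mlieBracket_vectorField (n := 3) (m := 2)
      (Z.contMDiff.contMDiffAt.of_le (hle 3)) (by
        rw [minSmoothness_of_isRCLikeNormedField]; norm_cast)).mdifferentiableAt (by simp)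
  have h1 (W : Cₛ^∞⟮𝓡 n; EuclideanSpace ℝ (Fin n), (TangentSpace (𝓡 n) : M → Type)⟯)
      {Wf : C^∞⟮𝓡 n, M; ℝ⟯} (hWf : ∀ y : M, Wf y = dirDeriv f y (W y)) :
      mlieBracket (𝓡 n) W ((f : M → ℝ) • (Z : ∀ y, TangentSpace (𝓡 n) y))
        = (Wf : M → ℝ) • (Z : ∀ y, TangentSpace (𝓡 n) y) + (f : M → ℝ) • mlieBracket (𝓡 n) W Z := by
    funext y
    rw [mlieBracket_smul_right (hd f y) (hs Z y)]
    show _ = Wf y • Z y + f y • mlieBracket (𝓡 n) W Z y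
    rw [hWf]
    rfl
  have h2 (W : Cₛ^∞⟮𝓡 n; EuclideanSpace ℝ (Fin n), (TangentSpace (𝓡 n) : M → Type)⟯)
      (W' : Cₛ^∞⟮𝓡 n; EuclideanSpace ℝ (Fin n), (TangentSpace (𝓡 n) : M → Type)⟯)
      {Wf W'f : C^∞⟮𝓡 n, M; ℝ⟯} (hWf : ∀ y : M, Wf y = dirDeriv f y (W y))
      (hWf' : ∀ y : M, W'f y = dirDeriv f y (W' y)) :
      mlieBracket (𝓡 n) W' (mlieBracket (𝓡 n) W ((f : M → ℝ) • (Z : ∀ y, TangentSpace (𝓡 n) y))) x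
        = (dirDeriv Wf x (W' x) • Z x + Wf x • mlieBracket (𝓡 n) W' Z x)
          + (W'f x • mlieBracket (𝓡 n) W Z x
            + f x • mlieBracket (𝓡 n) W' (mlieBracket (𝓡 n) W Z) x) := by
    rw [h1 W hWf, mlieBracket_add_right, mlieBracket_smul_right (hd Wf x) (hs Z x),
      mlieBracket_smul_right (hd f x) (hb W x), hWf']
    · rfl
    · exact (hd Wf x).smul_section (hs Z x)
    · exact (hd f x).smul_section (hb W x)
  have hZ' (W : Cₛ^∞⟮𝓡 n; EuclideanSpace ℝ (Fin n), (TangentSpace (𝓡 n) : M → Type)⟯) :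
      ContMDiffAt (𝓡 n) (𝓡 n).tangent (minSmoothness ℝ 2)
        (fun x => (⟨x, W x⟩ : TangentBundle (𝓡 n) M)) x := W.contMDiff.contMDiffAt.of_le (hmin 2)
  have h3 := leibniz_identity_mlieBracket_apply (hZ' X) (hZ' Y) (hZ' (f • Z))
  have h4 := leibniz_identity_mlieBracket_apply (hZ' X) (hZ' Y) (hZ' Z)
  have h5 := mlieBracket_smul_right (V := mlieBracket (𝓡 n) X Y) (hd f x) (hs Z x)
  change mlieBracket (𝓡 n) X (mlieBracket (𝓡 n) Y ((f : M → ℝ) • (Z : ∀ y, TangentSpace (𝓡 n) y))) x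
    = mlieBracket (𝓡 n) _ ((f : M → ℝ) • (Z : ∀ y, TangentSpace (𝓡 n) y)) x +
      mlieBracket (𝓡 n) Y (mlieBracket (𝓡 n) X ((f : M → ℝ) • (Z : ∀ y, TangentSpace (𝓡 n) y))) x at h3
  rw [h2 Y X hYf hXf, h2 X Y hXf hYf, h5, h4] at h3
  change _ = dirDeriv f x (mlieBracket (𝓡 n) X Y x) • Z x + _ + _ at h3
  have h6 : (dirDeriv f x (mlieBracket (𝓡 n) X Y x) - (dirDeriv Yf x (X x) - dirDeriv Xf x (Y x)))
      • Z x = 0 := by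
    linear_combination (norm := module) -h3
  rw [hZ] at h6
  exact sub_eq_zero.1 ((smul_eq_zero.1 h6).resolve_right hz)

end TangentVectors

/-! ### Sections as a module over smooth functions -/

section SectionModule

variable {n : ℕ} {M : Type*} [TopologicalSpace M]
  [ChartedSpace (EuclideanSpace ℝ (Fin n)) M]
  {F : Type*} [NormedAddCommGroup F] [NormedSpace ℝ F]
  {V : M → Type*} [TopologicalSpace (TotalSpace F V)]
  [∀ x, AddCommGroup (V x)] [∀ x, Module ℝ (V x)] [∀ x, TopologicalSpace (V x)]
  [FiberBundle F V] [VectorBundle ℝ F V]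

/-- With the invertibility of 2 and the faithfulness below, this makes the algebraic lemmas
applicable to smooth functions and sections. -/
instance : IsReduced C^∞⟮𝓡 n, M; ℝ⟯ where
  eq_zero f hf := by
    obtain ⟨k, hk⟩ := hf
    ext x
    have h1 : ContMDiffMap.evalRingHom x (f ^ k) = (f x) ^ k := map_pow _ f k
    rw [hk, map_zero] at h1
    exact eq_zero_of_pow_eq_zero h1.symm

instance : Invertible (2 : C^∞⟮𝓡 n, M; ℝ⟯) where
  invOf := algebraMap ℝ _ 2⁻¹
  invOf_mul_self := by
    rw [← map_ofNat (algebraMap ℝ C^∞⟮𝓡 n, M; ℝ⟯) 2, ← map_mul, inv_mul_cancel₀ two_ne_zero, map_one]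
  mul_invOf_self := by
    rw [← map_ofNat (algebraMap ℝ C^∞⟮𝓡 n, M; ℝ⟯) 2, ← map_mul, mul_inv_cancel₀ two_ne_zero, map_one]

instance : IsScalarTower ℝ C^∞⟮𝓡 n, M; ℝ⟯ Cₛ^∞⟮𝓡 n; F, V⟯ where
  smul_assoc r f X := by
    ext x
    exact smul_assoc r (f x) (X x)

theorem finrank_fiber (x : M) : Module.finrank ℝ (V x) = Module.finrank ℝ F :=
  ((trivializationAt F V x).linearEquivAt ℝ x
    (FiberBundle.mem_baseSet_trivializationAt F V x)).finrank_eq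

theorem smoothSection_sum_apply {ι : Type*} (s : Finset ι) (X : ι → Cₛ^∞⟮𝓡 n; F, V⟯) (x : M) :
    (∑ i ∈ s, X i) x = ∑ i ∈ s, X i x :=
  map_sum (⟨⟨fun X => X x, rfl⟩, fun _ _ => rfl⟩ : Cₛ^∞⟮𝓡 n; F, V⟯ →+ V x) X s

variable [T2Space M] [IsManifold (𝓡 n) ∞ M] [ContMDiffVectorBundle ∞ F V (𝓡 n)]

instance [Nontrivial F] : FaithfulSMul C^∞⟮𝓡 n, M; ℝ⟯ Cₛ^∞⟮𝓡 n; F, V⟯ where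
  eq_of_smul_eq_smul {f g} h := by
    ext x
    have : Nontrivial (V x) := ((trivializationAt F V x).linearEquivAt ℝ x
      (FiberBundle.mem_baseSet_trivializationAt F V x)).toEquiv.nontrivial
    obtain ⟨v, hv⟩ := exists_ne (0 : V x)
    obtain ⟨X, hX⟩ := exists_section_apply_eq (n := n) (F := F) x v
    have h1 : f x • X x = g x • X x := congrArg (fun Y : Cₛ^∞⟮𝓡 n; F, V⟯ => Y x) (h X)
    rw [hX] at h1
    exact smul_left_injective ℝ hv h1

/-- Near any point there are global sections which form a frame, and in terms of which each vector
is expressed through its coordinates in a trivialization. -/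
theorem exists_smooth_frame [FiniteDimensional ℝ F] (p : M) :
    ∃ E : Fin (Module.finrank ℝ F) → Cₛ^∞⟮𝓡 n; F, V⟯, ∀ᶠ y in 𝓝 p, ∀ v : V y,
      v = ∑ j, (Module.finBasis ℝ F).repr (trivializationAt F V p ⟨y, v⟩).2 j • E j y := by
  set e := trivializationAt F V p
  have hp : p ∈ e.baseSet := FiberBundle.mem_baseSet_trivializationAt F V p
  have hE (j) : ∃ X : Cₛ^∞⟮𝓡 n; F, V⟯, ∀ᶠ y in 𝓝 p,
      X y = e.localFrame (Module.finBasis ℝ F) j y :=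
    exists_section_eventuallyEq (n := n) e.open_baseSet hp
      (e.contMDiffOn_localFrame_baseSet ∞ _ j)
  choose E hE using hE
  refine ⟨E, ?_⟩
  filter_upwards [Filter.eventually_all.2 hE, e.open_baseSet.mem_nhds hp] with y hy hye v
  simp only [hy, e.localFrame_apply_of_mem_baseSet _ hye]
  have h1 := ((e.basisAt (Module.finBasis ℝ F) hye).sum_repr v).symm
  simpa [Trivialization.basisAt] using h1

/-- An operator on sections which is linear over the smooth functions is pointwise. -/
theorem apply_eq_zero_of_smooth_linear [FiniteDimensional ℝ F]
    (T : Cₛ^∞⟮𝓡 n; F, V⟯ →ₗ[C^∞⟮𝓡 n, M; ℝ⟯] C^∞⟮𝓡 n, M; ℝ⟯) {X : Cₛ^∞⟮𝓡 n; F, V⟯} {x : M}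
    (hX : X x = 0) : T X x = 0 := by
  obtain ⟨E, hE⟩ := exists_smooth_frame (n := n) (F := F) (V := V) x
  set e := trivializationAt F V x
  have hx : x ∈ e.baseSet := FiberBundle.mem_baseSet_trivializationAt F V x
  have hc (j) : ∃ c : C^∞⟮𝓡 n, M; ℝ⟯,
      c =ᶠ[𝓝 x] fun y => (Module.finBasis ℝ F).repr (e ⟨y, X y⟩).2 j := by
    refine exists_smooth_eventuallyEq (n := n) e.open_baseSet hx ?_
    exact ((LinearMap.toContinuousLinearMap ((Module.finBasis ℝ F).coord j)).contMDiff
      ).comp_contMDiffOn ((e.contMDiffOn_section_baseSet_iff).1 X.contMDiff.contMDiffOn)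
  choose c hc using hc
  have hcx (j) : c j x = 0 := by
    rw [(hc j).self_of_nhds]
    dsimp only
    rw [hX]
    have : (e ⟨x, (0 : V x)⟩).2 = 0 := (e.linearEquivAt ℝ x hx).map_zero
    rw [this, map_zero, Finsupp.zero_apply]
  have hXE : ∀ᶠ y in 𝓝 x, X y = ∑ j, c j y • E j y := by
    filter_upwards [hE, Filter.eventually_all.2 hc] with y hy hcy
    simp only [hcy]
    exact hy (X y)
  obtain ⟨χ, hχ, hs⟩ := exists_smooth_cutoff (n := n) hXE
  -- The cutoff makes the local frame expansion a global identity, to which linearity of `T`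
  -- applies; the coefficients vanish at `x`.
  have hmul : χ • X = χ • ∑ j, c j • E j := by
    ext y
    rw [smoothSection_smul_apply, smoothSection_smul_apply, smoothSection_sum_apply]
    by_cases hy : y ∈ tsupport χ
    · rw [(hs hy : X y = _)]
      rfl
    · rw [image_eq_zero_of_notMem_tsupport hy, zero_smul, zero_smul]
  have h1 := congrArg (ContMDiffMap.evalRingHom x) (congrArg T hmul)
  simp only [map_smul, map_sum, smul_eq_mul, map_mul] at h1
  have h2 : ContMDiffMap.evalRingHom x χ = 1 := hχ.self_of_nhds
  have h3 (j) : ContMDiffMap.evalRingHom x (c j) = 0 := hcx j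
  simp only [h2, h3, one_mul, zero_mul, Finset.sum_const_zero] at h1
  exact h1

end SectionModule

/-! ### Symbols as vector fields -/

namespace IsBracketSymbol

variable {n : ℕ} {M : Type*} [TopologicalSpace M]
  [ChartedSpace (EuclideanSpace ℝ (Fin n)) M]
  {F : Type*} [NormedAddCommGroup F] [NormedSpace ℝ F] [Nontrivial F]
  {V : M → Type*} [TopologicalSpace (TotalSpace F V)]
  [∀ x, AddCommGroup (V x)] [∀ x, Module ℝ (V x)] [∀ x, TopologicalSpace (V x)]
  [FiberBundle F V] [VectorBundle ℝ F V]
  [T2Space M] [IsManifold (𝓡 n) ∞ M] [ContMDiffVectorBundle ∞ F V (𝓡 n)]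
  {br : Cₛ^∞⟮𝓡 n; F, V⟯ →ₗ[ℝ] Cₛ^∞⟮𝓡 n; F, V⟯ →ₗ[ℝ] Cₛ^∞⟮𝓡 n; F, V⟯}
  {a b : Cₛ^∞⟮𝓡 n; F, V⟯ → C^∞⟮𝓡 n, M; ℝ⟯ → C^∞⟮𝓡 n, M; ℝ⟯}

/-- `a X` followed by evaluation is a point derivation everywhere; the resulting field is smooth
because its derivative of each `f` is the smooth function `a X f`. -/
theorem exists_vectorField (h : IsBracketSymbol br a b) (X : Cₛ^∞⟮𝓡 n; F, V⟯) :
    ∃ v : Cₛ^∞⟮𝓡 n; EuclideanSpace ℝ (Fin n), (TangentSpace (𝓡 n) : M → Type)⟯,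
      ∀ (f : C^∞⟮𝓡 n, M; ℝ⟯) (x : M), dirDeriv f x (v x) = a X f x := by
  have hD (x : M) : ∃ w : TangentSpace (𝓡 n) x, ∀ f : C^∞⟮𝓡 n, M; ℝ⟯,
      a X f x = dirDeriv f x w :=
    IsPointDerivation.exists_eq_dirDeriv (D :=
      { toFun := fun f => a X f x
        map_add' := fun f g => by rw [h.add]; rfl
        map_smul' := fun r f => by rw [h.map_smul]; rfl }) fun f g => by
      show a X (f * g) x = f x * a X g x + g x * a X f x
      rw [h.mul]; rfl
  choose v hv using hD
  exact ⟨⟨v, fun x => contMDiffAt_tangentBundle_of_dirDeriv contMDiffAt_id fun f =>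
    (a X f).contMDiff.contMDiffAt.congr_of_eventuallyEq (.of_forall fun y => (hv y f).symm)⟩,
    fun f x => (hv x f).symm⟩

/-- The vector field given by the symbol of the bracket with a section. -/
def vectorField (h : IsBracketSymbol br a b) (X : Cₛ^∞⟮𝓡 n; F, V⟯) :
    Cₛ^∞⟮𝓡 n; EuclideanSpace ℝ (Fin n), (TangentSpace (𝓡 n) : M → Type)⟯ :=
  (h.exists_vectorField X).choose

@[simp]
theorem dirDeriv_vectorField (h : IsBracketSymbol br a b) (X : Cₛ^∞⟮𝓡 n; F, V⟯)
    (f : C^∞⟮𝓡 n, M; ℝ⟯) (x : M) : dirDeriv f x (h.vectorField X x) = a X f x :=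
  (h.exists_vectorField X).choose_spec f x

theorem vectorField_apply_eq_iff (h : IsBracketSymbol br a b) {X : Cₛ^∞⟮𝓡 n; F, V⟯} {x : M}
    {w : TangentSpace (𝓡 n) x} :
    h.vectorField X x = w ↔ ∀ f : C^∞⟮𝓡 n, M; ℝ⟯, a X f x = dirDeriv f x w := by
  refine ⟨fun hw f => by rw [← hw, h.dirDeriv_vectorField], fun hw => ?_⟩
  exact eq_of_forall_dirDeriv_eq fun f => by rw [h.dirDeriv_vectorField, hw]

omit [Nontrivial F] in
/-- In rank greater than one the symbol is linear over the smooth functions. -/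
theorem smul_left [FiniteDimensional ℝ F] (hF : 1 < Module.finrank ℝ F)
    (h : IsBracketSymbol br a b) (X : Cₛ^∞⟮𝓡 n; F, V⟯) (f g : C^∞⟮𝓡 n, M; ℝ⟯) :
    a (f • X) g = f * a X g := by
  ext x
  have : Module.Finite ℝ (V x) := Module.finite_of_finrank_pos (by rw [finrank_fiber (F := F)]; omega)
  -- A fibre of dimension above one is not spanned by `X x`.
  obtain ⟨v, hv⟩ : ∃ v : V x, v ∉ Submodule.span ℝ {X x} := by
    by_contra! hall
    have h1 := finrank_span_le_card (R := ℝ) ({X x} : Set (V x))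
    rw [(Submodule.eq_top_iff'.2 hall), finrank_top, finrank_fiber (F := F)] at h1
    simp at h1
    omega
  obtain ⟨Y, rfl⟩ := exists_section_apply_eq (n := n) (F := F) x v
  have h1 : (a (f • X) g x - f x * a X g x) • Y x = (b (g • Y) f x - g x * b Y f x) • X x :=
    congrArg (fun Z : Cₛ^∞⟮𝓡 n; F, V⟯ => Z x) (h.smul_left_sub_smul X Y f g)
  show a (f • X) g x = f x * a X g x
  by_contra hne
  refine hv (Submodule.mem_span_singleton.2
    ⟨(a (f • X) g x - f x * a X g x)⁻¹ * (b (g • Y) f x - g x * b Y f x), ?_⟩)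
  rw [mul_smul, ← h1, inv_smul_smul₀ (sub_ne_zero.2 hne)]

end IsBracketSymbol

/-! ### The anchor in rank greater than one -/

namespace IsBracketSymbol

variable {n : ℕ} {M : Type*} [TopologicalSpace M]
  [ChartedSpace (EuclideanSpace ℝ (Fin n)) M]
  {F : Type*} [NormedAddCommGroup F] [NormedSpace ℝ F] [Nontrivial F]
  {V : M → Type*} [TopologicalSpace (TotalSpace F V)]
  [∀ x, AddCommGroup (V x)] [∀ x, Module ℝ (V x)] [∀ x, TopologicalSpace (V x)]
  [FiberBundle F V] [VectorBundle ℝ F V]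
  [T2Space M] [IsManifold (𝓡 n) ∞ M] [ContMDiffVectorBundle ∞ F V (𝓡 n)]
  [FiniteDimensional ℝ F]
  {br : Cₛ^∞⟮𝓡 n; F, V⟯ →ₗ[ℝ] Cₛ^∞⟮𝓡 n; F, V⟯ →ₗ[ℝ] Cₛ^∞⟮𝓡 n; F, V⟯}
  {a b : Cₛ^∞⟮𝓡 n; F, V⟯ → C^∞⟮𝓡 n, M; ℝ⟯ → C^∞⟮𝓡 n, M; ℝ⟯}

theorem apply_eq_of_apply_eq (hF : 1 < Module.finrank ℝ F) (h : IsBracketSymbol br a b)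
    {X Y : Cₛ^∞⟮𝓡 n; F, V⟯} {x : M} (hXY : X x = Y x) (f : C^∞⟮𝓡 n, M; ℝ⟯) :
    a X f x = a Y f x := by
  have h1 := apply_eq_zero_of_smooth_linear (T :=
    { toFun := fun X => a X f
      map_add' := fun X Y => h.add_left X Y f
      map_smul' := fun g X => h.smul_left hF X g f }) (X := X - Y) (x := x)
    (by show X x - Y x = 0; rw [hXY, sub_self])
  have h2 := h.add_left (X - Y) Y f
  rw [sub_add_cancel] at h2
  rw [h2]
  exact (congrArg (· + a Y f x) h1).trans (zero_add _)

/-- In rank greater than one the symbol is given by a morphism to the tangent bundle. -/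
theorem exists_anchor (hF : 1 < Module.finrank ℝ F) (h : IsBracketSymbol br a b) :
    ∃ α : AnchorMorphism (𝓡 n) F V, ∀ (X : Cₛ^∞⟮𝓡 n; F, V⟯) (x : M),
      α.toFun x (X x) = h.vectorField X x := by
  choose s hs using fun (x : M) (v : V x) => exists_section_apply_eq (n := n) (F := F) x v
  have hval (X : Cₛ^∞⟮𝓡 n; F, V⟯) (x : M) :
      h.vectorField (s x (X x)) x = h.vectorField X x := by
    rw [vectorField_apply_eq_iff]
    exact fun f => by
      rw [h.dirDeriv_vectorField]; exact h.apply_eq_of_apply_eq hF (hs x (X x)) f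
  have hadd (x : M) (v w : V x) : h.vectorField (s x (v + w)) x
      = h.vectorField (s x v) x + h.vectorField (s x w) x := by
    rw [vectorField_apply_eq_iff]
    intro f
    rw [dirDeriv_add, h.dirDeriv_vectorField, h.dirDeriv_vectorField,
      h.apply_eq_of_apply_eq hF (Y := s x v + s x w), h.add_left]
    · rfl
    · show _ = s x v x + s x w x
      simp only [hs]
  have hsmul (x : M) (r : ℝ) (v : V x) : h.vectorField (s x (r • v)) x
      = r • h.vectorField (s x v) x := by
    rw [vectorField_apply_eq_iff]
    intro f
    rw [dirDeriv_smul, h.dirDeriv_vectorField,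
      h.apply_eq_of_apply_eq hF (Y := r • s x v), h.map_smul_left]
    · rfl
    · show _ = r • s x v x
      simp only [hs]
  refine ⟨⟨fun x => ⟨⟨fun v => h.vectorField (s x v) x, hadd x⟩, hsmul x⟩, fun v₀ => ?_⟩,
    fun X x => hval X x⟩
  refine contMDiffAt_tangentBundle_of_dirDeriv (n := n) ?_ fun f => ?_
  · exact (contMDiff_proj V).contMDiffAt
  obtain ⟨E, hE⟩ := exists_smooth_frame (n := n) (F := F) (V := V) v₀.proj
  set e := trivializationAt F V v₀.proj
  have hproj : ContMDiffAt ((𝓡 n).prod 𝓘(ℝ, F)) (𝓡 n) ∞ (fun v : TotalSpace F V => v.proj) v₀ :=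
    (contMDiff_proj V).contMDiffAt
  have hcoord : ContMDiffAt ((𝓡 n).prod 𝓘(ℝ, F)) 𝓘(ℝ, F) ∞
      (fun v : TotalSpace F V => (e v).2) v₀ := (contMDiffAt_totalSpace.1 contMDiffAt_id).2
  -- In a frame `E j`, the derivative of `f` along the anchor is a sum of fibre coordinates times
  -- the functions `a (E j) f` of the base point.
  have hsm : ContMDiffAt ((𝓡 n).prod 𝓘(ℝ, F)) 𝓘(ℝ, ℝ) ∞ (fun v : TotalSpace F V =>
      ∑ j, (Module.finBasis ℝ F).repr (e v).2 j * a (E j) f v.proj) v₀ := by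
    refine contMDiffAt_finsetSum fun j _ => ?_
    refine ContMDiffAt.mul ?_ ((a (E j) f).contMDiff.contMDiffAt.comp v₀ hproj)
    exact (LinearMap.toContinuousLinearMap ((Module.finBasis ℝ F).coord j)
      ).contMDiff.contMDiffAt.comp v₀ hcoord
  refine hsm.congr_of_eventuallyEq ?_
  filter_upwards [hproj.continuousAt.eventually hE] with v hv
  show dirDeriv f v.proj (h.vectorField (s v.proj v.2) v.proj) = _
  -- The coordinates of the single vector `v` are frozen as real constants, so real linearity of the
  -- symbol suffices here.
  set r := fun j => (Module.finBasis ℝ F).repr (e v).2 j with hr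
  have h1 : v.2 = (∑ j, r j • E j) v.proj := by
    rw [smoothSection_sum_apply]
    exact hv v.2
  rw [h.dirDeriv_vectorField, h.apply_eq_of_apply_eq hF (Y := ∑ j, r j • E j) ((hs _ _).trans h1)]
  have h2 : a (∑ j, r j • E j) f = ∑ j, r j • a (E j) f := by
    have := map_sum (⟨⟨fun X => a X f, h.map_zero_left f⟩, fun X Y => h.add_left X Y f⟩ :
      Cₛ^∞⟮𝓡 n; F, V⟯ →+ C^∞⟮𝓡 n, M; ℝ⟯) (fun j => r j • E j) Finset.univ
    refine this.trans (Finset.sum_congr rfl fun j _ => h.map_smul_left (E j) (r j) f)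
  rw [h2]
  have h3 := map_sum (ContMDiffMap.evalRingHom (I := 𝓡 n) (I' := 𝓘(ℝ, ℝ)) (n := ∞) v.proj)
    (fun j => r j • a (E j) f) Finset.univ
  exact h3

end IsBracketSymbol

/-! ### Assembling the statement in rank greater than one -/

section RankGreaterThanOne

variable {n : ℕ} {M : Type*} [TopologicalSpace M] [T2Space M]
    [ChartedSpace (EuclideanSpace ℝ (Fin n)) M] [IsManifold (𝓡 n) ∞ M]
    {F : Type*} [NormedAddCommGroup F] [NormedSpace ℝ F] [FiniteDimensional ℝ F]
    {V : M → Type*} [TopologicalSpace (TotalSpace F V)]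
    [∀ x, AddCommGroup (V x)] [∀ x, Module ℝ (V x)] [∀ x, TopologicalSpace (V x)]
    [FiberBundle F V] [VectorBundle ℝ F V] [ContMDiffVectorBundle ∞ F V (𝓡 n)]
    {br : Cₛ^∞⟮𝓡 n; F, V⟯ →ₗ[ℝ] Cₛ^∞⟮𝓡 n; F, V⟯ →ₗ[ℝ] Cₛ^∞⟮𝓡 n; F, V⟯}

theorem exists_anchor_of_one_lt_finrank (hjac : SatisfiesJacobi br)
    (hright : ∀ X, IsQuasiDerivation ℝ C^∞⟮𝓡 n, M; ℝ⟯ (br X))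
    (hleft : ∀ Y, IsQuasiDerivation ℝ C^∞⟮𝓡 n, M; ℝ⟯ (br.flip Y))
    (hF : 1 < Module.finrank ℝ F) :
      ∃ a : AnchorMorphism (𝓡 n) F V,
        (∀ (X Y : Cₛ^∞⟮𝓡 n; F, V⟯) (x : M),
          a.toFun x (br X Y x) =
            VectorField.mlieBracket (𝓡 n)
              (fun y => a.toFun y (X y)) (fun y => a.toFun y (Y y)) x) ∧
        (∀ (X Y : Cₛ^∞⟮𝓡 n; F, V⟯) (f g : C^∞⟮𝓡 n, M; ℝ⟯) (x : M),
          br (f • X) (g • Y) x =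
            (f x * g x) • br X Y x
              + (f x * dirDeriv g x (a.toFun x (X x))) • Y x
              - (g x * dirDeriv f x (a.toFun x (Y x))) • X x) ∧
        (∀ (X Y : Cₛ^∞⟮𝓡 n; F, V⟯) (p : M), a.toFun p ≠ 0 → br X Y p = -(br Y X p)) := by
  have : Nontrivial F := Module.nontrivial_of_finrank_pos (R := ℝ) (by omega)
  obtain ⟨a, b, h⟩ := IsBracketSymbol.exists_of_isQuasiDerivation hright hleft
  obtain ⟨α, hα⟩ := h.exists_anchor hF
  refine ⟨α, fun X Y x => ?_, fun X Y f g x => ?_, fun X Y p hp => ?_⟩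
  · simp only [hα]
    rw [h.vectorField_apply_eq_iff]
    intro f
    rw [dirDeriv_mlieBracket (fun y => (h.dirDeriv_vectorField X f y).symm)
      (fun y => (h.dirDeriv_vectorField Y f y).symm), h.bracket hjac, h.dirDeriv_vectorField,
      h.dirDeriv_vectorField]
    rfl
  · have hb : b Y f = -a Y f := eq_neg_of_add_eq_zero_right (h.add_eq_zero hjac Y f)
    rw [hα, hα, h.dirDeriv_vectorField, h.dirDeriv_vectorField, h.right, h.left, hb,
      h.smul_left hF]
    show g x • (f x • br X Y x + -a Y f x • X x) + (f x * a X g x) • Y x = _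
    module
  · obtain ⟨v, hv⟩ : ∃ v, α.toFun p v ≠ 0 := by
      by_contra! h0
      exact hp (LinearMap.ext h0)
    obtain ⟨Z, rfl⟩ := exists_section_apply_eq (n := n) (F := F) p v
    obtain ⟨f, hf⟩ : ∃ f : C^∞⟮𝓡 n, M; ℝ⟯, a Z f p ≠ 0 := by
      by_contra! h0
      refine hv ?_
      rw [hα, h.vectorField_apply_eq_iff]
      exact fun f => (h0 f).trans (map_zero _).symm
    have h1 : a Z f p • (br X Y p + br Y X p) = 0 :=
      congrArg (fun W : Cₛ^∞⟮𝓡 n; F, V⟯ => W p) (h.smul_add_bracket_swap hjac X Y Z f)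
    exact eq_neg_of_add_eq_zero_left ((smul_eq_zero.1 h1).resolve_left hf)

end RankGreaterThanOne

/-! ### Rank one: skew-symmetry and locality -/

section RankOne

variable {n : ℕ} {M : Type*} [TopologicalSpace M] [T2Space M]
    [ChartedSpace (EuclideanSpace ℝ (Fin n)) M] [IsManifold (𝓡 n) ∞ M]
    {F : Type*} [NormedAddCommGroup F] [NormedSpace ℝ F]
    {V : M → Type*} [TopologicalSpace (TotalSpace F V)]
    [∀ x, AddCommGroup (V x)] [∀ x, Module ℝ (V x)] [∀ x, TopologicalSpace (V x)]
    [FiberBundle F V] [VectorBundle ℝ F V] [ContMDiffVectorBundle ∞ F V (𝓡 n)]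
    {br : Cₛ^∞⟮𝓡 n; F, V⟯ →ₗ[ℝ] Cₛ^∞⟮𝓡 n; F, V⟯ →ₗ[ℝ] Cₛ^∞⟮𝓡 n; F, V⟯}
    {a b : Cₛ^∞⟮𝓡 n; F, V⟯ → C^∞⟮𝓡 n, M; ℝ⟯ → C^∞⟮𝓡 n, M; ℝ⟯}

/-- In rank one any two sections are proportional near a point where one of them is non-zero. -/
theorem exists_smul_eq_smul (hF : Module.finrank ℝ F = 1) {s : Cₛ^∞⟮𝓡 n; F, V⟯} {p : M}
    (hs : s p ≠ 0) (X : Cₛ^∞⟮𝓡 n; F, V⟯) :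
    ∃ u f : C^∞⟮𝓡 n, M; ℝ⟯, u p ≠ 0 ∧ u • X = f • s := by
  have : FiniteDimensional ℝ F := Module.finite_of_finrank_pos (by omega)
  set e := trivializationAt F V p
  have hp : p ∈ e.baseSet := FiberBundle.mem_baseSet_trivializationAt F V p
  let φ : F ≃ₗ[ℝ] ℝ := LinearEquiv.ofFinrankEq _ _ (by rw [hF, Module.finrank_self])
  have hc (Y : Cₛ^∞⟮𝓡 n; F, V⟯) : ∃ c : C^∞⟮𝓡 n, M; ℝ⟯,
      c =ᶠ[𝓝 p] fun y => φ (e ⟨y, Y y⟩).2 := by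
    refine exists_smooth_eventuallyEq (n := n) e.open_baseSet hp ?_
    exact ((LinearMap.toContinuousLinearMap (φ : F →ₗ[ℝ] ℝ)).contMDiff
      ).comp_contMDiffOn ((e.contMDiffOn_section_baseSet_iff).1 Y.contMDiff.contMDiffOn)
  obtain ⟨cs, hcs⟩ := hc s
  obtain ⟨cX, hcX⟩ := hc X
  have hprop : ∀ᶠ y in 𝓝 p, cs y • X y = cX y • s y := by
    filter_upwards [hcs, hcX, e.open_baseSet.mem_nhds hp] with y hs hX hy
    let ψ : V y ≃ₗ[ℝ] ℝ := (e.linearEquivAt ℝ y hy).trans φ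
    refine ψ.injective ?_
    rw [map_smul, map_smul, hs, hX, smul_eq_mul, smul_eq_mul]
    exact mul_comm (ψ (s y)) (ψ (X y))
  obtain ⟨χ, hχ, hsupp⟩ := exists_smooth_cutoff (n := n) hprop
  refine ⟨χ * cs, χ * cX, ?_, ?_⟩
  · show χ p * cs p ≠ 0
    rw [hχ.self_of_nhds, Pi.one_apply, one_mul, hcs.self_of_nhds]
    exact ((e.linearEquivAt ℝ p hp).trans φ).map_ne_zero_iff.2 hs
  · ext y
    rw [mul_smul, mul_smul]
    show χ y • cs y • X y = χ y • cX y • s y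
    by_cases hy : y ∈ tsupport χ
    · rw [(hsupp hy : cs y • X y = cX y • s y)]
    · rw [image_eq_zero_of_notMem_tsupport hy, zero_smul, zero_smul]

namespace IsBracketSymbol

-- Expand `[χ(X - X'), Y] = 0` for a cutoff `χ` and evaluate at `x`, where `χ = 1` and `X - X' = 0`.
omit [ContMDiffVectorBundle ∞ F V (𝓡 n)] in
theorem left_eq_of_eventuallyEq (h : IsBracketSymbol br a b) {X X' : Cₛ^∞⟮𝓡 n; F, V⟯} {x : M}
    (hX : ∀ᶠ y in 𝓝 x, X y = X' y) (Y : Cₛ^∞⟮𝓡 n; F, V⟯) : br X Y x = br X' Y x := by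
  obtain ⟨χ, hχ, hsupp⟩ := exists_smooth_cutoff (n := n) hX
  have h0 : χ • (X - X') = 0 := by
    ext y
    show χ y • (X y - X' y) = 0
    by_cases hy : y ∈ tsupport χ
    · rw [(hsupp hy : X y = X' y), sub_self, smul_zero]
    · rw [image_eq_zero_of_notMem_tsupport hy, zero_smul]
  have h1 := h.left (X - X') χ Y
  rw [h0, map_zero, map_sub, LinearMap.zero_apply, LinearMap.sub_apply] at h1
  have h2 : (0 : V x) = χ x • (br X Y x - br X' Y x) + b Y χ x • (X x - X' x) :=
    congrArg (fun Z : Cₛ^∞⟮𝓡 n; F, V⟯ => Z x) h1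
  rw [hχ.self_of_nhds, Pi.one_apply, one_smul, hX.self_of_nhds, sub_self, smul_zero,
    add_zero] at h2
  exact sub_eq_zero.1 h2.symm

omit [ContMDiffVectorBundle ∞ F V (𝓡 n)] in
theorem right_eq_of_eventuallyEq (h : IsBracketSymbol br a b) (X : Cₛ^∞⟮𝓡 n; F, V⟯)
    {Y Y' : Cₛ^∞⟮𝓡 n; F, V⟯} {x : M} (hY : ∀ᶠ y in 𝓝 x, Y y = Y' y) : br X Y x = br X Y' x :=
  h.flip.left_eq_of_eventuallyEq hY X

variable (h : IsBracketSymbol br a b) (hjac : SatisfiesJacobi br)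
include h hjac

theorem skew_of_finrank_eq_one (hF : Module.finrank ℝ F = 1) (X Y : Cₛ^∞⟮𝓡 n; F, V⟯) :
    br X Y = -br Y X := by
  have : Nontrivial F := Module.nontrivial_of_finrank_pos (R := ℝ) (by omega)
  -- Opposite symbols make the symmetric part of the bracket linear over functions.
  have hS (f : C^∞⟮𝓡 n, M; ℝ⟯) (X Y : Cₛ^∞⟮𝓡 n; F, V⟯) :
      br (f • X) Y + br Y (f • X) = f • (br X Y + br Y X) := by
    rw [h.left, h.right]
    linear_combination (norm := module) (h.add_eq_zero hjac Y f) • X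
  refine eq_neg_of_add_eq_zero_left ?_
  set s := br X Y + br Y X with hs
  have hss : br s s = 0 := by
    have h0 (Z : Cₛ^∞⟮𝓡 n; F, V⟯) : br s Z = 0 := by
      rw [hs, map_add, LinearMap.add_apply, hjac X Y Z, hjac Y X Z]
      abel
    exact h0 s
  ext p
  by_contra hp
  obtain ⟨u, f, hu, hX⟩ := exists_smul_eq_smul hF hp X
  obtain ⟨v, g, hv, hY⟩ := exists_smul_eq_smul hF hp Y
  -- By bilinearity, `uv s` is the symmetric part at `(uX, vY) = (fs, gs)`, a multiple of `[s,s] +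
  -- [s,s] = 0`.
  have h1 : (u * v) • s = 0 := by
    have h2 := hS u X (v • Y)
    rw [add_comm (br X (v • Y)), hS v Y X, add_comm (br Y X), ← hs, hX, hY, hS f s,
      add_comm (br s _), hS g s s, hss] at h2
    rw [mul_smul, ← h2]
    simp
  have h2 : (u p * v p) • s p = 0 := congrArg (fun Z : Cₛ^∞⟮𝓡 n; F, V⟯ => Z p) h1
  exact hp ((smul_eq_zero.1 h2).resolve_left (mul_ne_zero hu hv))

end IsBracketSymbol

theorem isLocalLieAlgebra_of_finrank_eq_one (h : IsBracketSymbol br a b)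
    (hjac : SatisfiesJacobi br) (hF : Module.finrank ℝ F = 1) : IsLocalLieAlgebra br := by
  have hskew := h.skew_of_finrank_eq_one hjac hF
  have hdiff {D : Cₛ^∞⟮𝓡 n; F, V⟯ →ₗ[ℝ] Cₛ^∞⟮𝓡 n; F, V⟯}
      {d : C^∞⟮𝓡 n, M; ℝ⟯ → C^∞⟮𝓡 n, M; ℝ⟯} (hD : ∀ f Y, D (f • Y) = f • D Y + d f • Y) :
      IsFirstOrderDiffOp ℝ C^∞⟮𝓡 n, M; ℝ⟯ D := by
    intro f g X
    rw [hD f (g • X), hD f X]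
    module
  have hsupp (X Y : Cₛ^∞⟮𝓡 n; F, V⟯) : sectionSupport (br X Y) ⊆ sectionSupport X := by
    refine closure_minimal (fun x hx => ?_) isClosed_closure
    by_contra hX
    refine hx ((h.left_eq_of_eventuallyEq (X' := 0) ?_ Y).trans ?_)
    · filter_upwards [isClosed_closure.isOpen_compl.mem_nhds hX] with y hy
      by_contra hne
      exact hy (subset_closure hne)
    · rw [map_zero]
      rfl
  refine ⟨fun X => ?_, hjac, fun X Y => subset_inter (hsupp X Y) ?_, fun X => hdiff (h.right X),
    fun Y => hdiff (h.flip.right Y)⟩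
  · have h1 := hskew X X
    ext x
    have h2 : br X X x = -br X X x := congrArg (fun Z : Cₛ^∞⟮𝓡 n; F, V⟯ => Z x) h1
    have h3 : (2 : ℝ) • br X X x = 0 := by
      rw [two_smul]; nth_rewrite 1 [h2]; exact neg_add_cancel _
    exact (smul_eq_zero.1 h3).resolve_left two_ne_zero
  · have h1 : {x | br X Y x ≠ 0} = {x | br Y X x ≠ 0} := by
      ext x
      have h2 : br X Y x = -br Y X x := congrArg (fun Z : Cₛ^∞⟮𝓡 n; F, V⟯ => Z x) (hskew X Y)
      simp only [mem_ofPred_eq, h2, ne_eq, neg_eq_zero]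
    show closure _ ⊆ _
    rw [h1]
    exact hsupp Y X

end RankOne

/-! ### Smoothness of tensor products of vector fields -/

section BivectorField

variable {n : ℕ} {M : Type*} [TopologicalSpace M]
    [ChartedSpace (EuclideanSpace ℝ (Fin n)) M] [IsManifold (𝓡 n) ∞ M]

/-- The tensor `v ⊗ w`, as a bilinear form on covectors. -/
def evalTensor {E : Type*} [NormedAddCommGroup E] [NormedSpace ℝ E] (v w : E) :
    (E →L[ℝ] ℝ) →L[ℝ] (E →L[ℝ] ℝ) →L[ℝ] ℝ :=
  (ContinuousLinearMap.apply ℝ ℝ v).smulRight (ContinuousLinearMap.apply ℝ ℝ w)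

/-- The tensor product of two tangent vectors. -/
def tangentTensor {x : M} (v w : TangentSpace (𝓡 n) x) :
    (TangentSpace (𝓡 n) x →L[ℝ] ℝ) →L[ℝ] (TangentSpace (𝓡 n) x →L[ℝ] ℝ) →L[ℝ] ℝ :=
  evalTensor (E := EuclideanSpace ℝ (Fin n)) v w

omit [IsManifold (𝓡 n) ∞ M] in
theorem tangentTensor_apply {x : M} (v w : TangentSpace (𝓡 n) x)
    (α β : TangentSpace (𝓡 n) x →L[ℝ] ℝ) : tangentTensor v w α β = α v * β w := rfl

theorem contMDiffAt_tangentTensor {v w : ∀ x : M, TangentSpace (𝓡 n) x} {x : M}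
    (hv : ContMDiffAt (𝓡 n) (𝓡 n).tangent ∞ (fun y => (⟨y, v y⟩ : TangentBundle (𝓡 n) M)) x)
    (hw : ContMDiffAt (𝓡 n) (𝓡 n).tangent ∞ (fun y => (⟨y, w y⟩ : TangentBundle (𝓡 n) M)) x) :
    ContMDiffAt (𝓡 n) ((𝓡 n).prod 𝓘(ℝ, (EuclideanSpace ℝ (Fin n) →L[ℝ] ℝ) →L[ℝ]
        (EuclideanSpace ℝ (Fin n) →L[ℝ] ℝ) →L[ℝ] ℝ)) ∞
      (fun y => TotalSpace.mk' ((EuclideanSpace ℝ (Fin n) →L[ℝ] ℝ) →L[ℝ]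
        (EuclideanSpace ℝ (Fin n) →L[ℝ] ℝ) →L[ℝ] ℝ)
        (E := fun x : M => (TangentSpace (𝓡 n) x →L[ℝ] ℝ) →L[ℝ]
          (TangentSpace (𝓡 n) x →L[ℝ] ℝ) →L[ℝ] ℝ) y (tangentTensor (v y) (w y))) x := by
  rw [contMDiffAt_hom_bundle]
  refine ⟨contMDiffAt_id, ?_⟩
  have hv' := (contMDiffAt_totalSpace.1 hv).2
  have hw' := (contMDiffAt_totalSpace.1 hw).2
  set e := trivializationAt (EuclideanSpace ℝ (Fin n)) (TangentSpace (𝓡 n) : M → Type) x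
  have hten : ContMDiffAt (𝓡 n) 𝓘(ℝ, (EuclideanSpace ℝ (Fin n) →L[ℝ] ℝ) →L[ℝ]
      (EuclideanSpace ℝ (Fin n) →L[ℝ] ℝ) →L[ℝ] ℝ) ∞
      (fun y => evalTensor (e ⟨y, v y⟩).2 (e ⟨y, w y⟩).2) x := by
    have hc : ContDiff ℝ ∞ (fun p : EuclideanSpace ℝ (Fin n) × EuclideanSpace ℝ (Fin n) =>
        evalTensor p.1 p.2) :=
      ((ContinuousLinearMap.apply ℝ ℝ).contDiff.comp contDiff_fst).smulRight
        ((ContinuousLinearMap.apply ℝ ℝ).contDiff.comp contDiff_snd)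
    exact hc.contMDiff.contMDiffAt.comp x (hv'.prodMk_space hw')
  refine hten.congr_of_eventuallyEq ?_
  filter_upwards [e.open_baseSet.mem_nhds (mem_baseSet_trivializationAt _ _ x)] with y hy
  ext α β
  -- The inverse of the cotangent trivialization is the transpose of the tangent one; hence the
  -- coordinates of `v ⊗ w` are the tensor of the coordinates.
  have hsymm (γ : EuclideanSpace ℝ (Fin n) →L[ℝ] ℝ) :
      (trivializationAt (EuclideanSpace ℝ (Fin n) →L[ℝ] ℝ)
        (fun x : M => TangentSpace (𝓡 n) x →L[ℝ] ℝ) x).symm y γ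
        = γ.comp (e.continuousLinearMapAt ℝ y) := by
    set ε := trivializationAt (EuclideanSpace ℝ (Fin n) →L[ℝ] ℝ)
        (fun x : M => TangentSpace (𝓡 n) x →L[ℝ] ℝ) x with hε
    have hyε : y ∈ ε.baseSet := by
      rw [hε, hom_trivializationAt_baseSet]
      exact ⟨hy, mem_univ y⟩
    have h1 : (ε ⟨y, γ.comp (e.continuousLinearMapAt ℝ y)⟩).2 = γ := by
      rw [hε, hom_trivializationAt_apply, ContinuousLinearMap.inCoordinates_eq hy (mem_univ y)]
      ext z
      have h2 := e.linearMapAt_symmₗ (R := ℝ) hy z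
      rw [e.symmₗ_apply hy] at h2
      simp [e]
      exact congrArg γ h2
    rw [← h1, ε.symm_apply_apply_mk hyε, h1]
  have hyε : y ∈ (trivializationAt (EuclideanSpace ℝ (Fin n) →L[ℝ] ℝ)
      (fun x : M => TangentSpace (𝓡 n) x →L[ℝ] ℝ) x).baseSet := by
    rw [hom_trivializationAt_baseSet]
    exact ⟨hy, mem_univ y⟩
  refine (inCoordinates_apply_eq₂ (E₃ := Bundle.Trivial M ℝ) hyε hyε (mem_univ y)).trans ?_
  rw [hsymm, hsymm, tangentTensor_apply]
  have h1 (z : TangentSpace (𝓡 n) y) : e.linearMapAt ℝ y z = (e ⟨y, z⟩).2 :=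
    congrFun (e.coe_linearMapAt_of_mem hy) z
  simp [h1]
  rfl

end BivectorField

/-! ### Coordinate vector fields -/

section CoordinateFields

variable {n : ℕ} {M : Type*} [TopologicalSpace M]
    [ChartedSpace (EuclideanSpace ℝ (Fin n)) M] [IsManifold (𝓡 n) ∞ M]

/-- The coordinate vector fields of the chart at `p`. -/
def coordinateField (p : M) (i : Fin n) (y : M) : TangentSpace (𝓡 n) y :=
  (trivializationAt (EuclideanSpace ℝ (Fin n)) (TangentSpace (𝓡 n) : M → Type) p).symm y
    (EuclideanSpace.single i 1)

theorem contMDiffAt_coordinateField {p y : M} (i : Fin n)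
    (hy : y ∈ (chartAt (EuclideanSpace ℝ (Fin n)) p).source) :
    ContMDiffAt (𝓡 n) (𝓡 n).tangent ∞
      (fun z => (⟨z, coordinateField p i z⟩ : TangentBundle (𝓡 n) M)) y := by
  set e := trivializationAt (EuclideanSpace ℝ (Fin n)) (TangentSpace (𝓡 n) : M → Type) p
  have h1 : ContMDiffOn (𝓡 n) (𝓡 n).tangent ∞
      (fun z => (⟨z, coordinateField p i z⟩ : TangentBundle (𝓡 n) M)) e.baseSet := by
    refine e.contMDiffOn_section_baseSet_iff.2 ?_
    refine (contMDiffOn_const (c := (EuclideanSpace.single i 1 : EuclideanSpace ℝ (Fin n)))).congr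
      fun z hz => ?_
    exact congrArg Prod.snd (e.apply_mk_symm hz _)
  have hy' : y ∈ e.baseSet := by simpa [e] using hy
  exact (h1 y hy').contMDiffAt (e.open_baseSet.mem_nhds hy')

theorem sum_dirDeriv_smul_coordinateField {p y : M} {u : Fin n → M → ℝ}
    (hy : y ∈ (chartAt (EuclideanSpace ℝ (Fin n)) p).source)
    (hu : ∀ i, u i =ᶠ[𝓝 y] fun z => extChartAt (𝓡 n) p z i) (w : TangentSpace (𝓡 n) y) :
    w = ∑ i, dirDeriv (u i) y w • coordinateField p i y := by
  set e := trivializationAt (EuclideanSpace ℝ (Fin n)) (TangentSpace (𝓡 n) : M → Type) p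
  have hy' : y ∈ e.baseSet := by simpa [e] using hy
  have h1 : (e ⟨y, w⟩).2
      = ∑ i, dirDeriv (u i) y w • (EuclideanSpace.single i 1 : EuclideanSpace ℝ (Fin n)) := by
    ext j
    rw [trivializationAt_tangent_apply hy (hu j)]
    simp [Pi.single_apply]
  have h2 := congrArg (e.symmₗ ℝ y) h1
  rw [map_sum] at h2
  simp only [map_smul] at h2
  simp only [e.symmₗ_apply hy'] at h2
  exact (e.symm_apply_apply_mk hy' w).symm.trans h2

end CoordinateFields

/-! ### Locality of the Jacobi operation -/

section JacobiOp

variable {n : ℕ} {M : Type*} [TopologicalSpace M]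
    [ChartedSpace (EuclideanSpace ℝ (Fin n)) M]

theorem jacobiOp_congr {L : TwoTensorField (𝓡 n) M} {G : ∀ x : M, TangentSpace (𝓡 n) x}
    {f f' g g' : M → ℝ} {x : M} (hf : f =ᶠ[𝓝 x] f') (hg : g =ᶠ[𝓝 x] g') :
    jacobiOp L G f g x = jacobiOp L G f' g' x := by
  have h1 : (mfderiv (𝓡 n) 𝓘(ℝ, ℝ) f x : TangentSpace (𝓡 n) x →L[ℝ] ℝ)
    = mfderiv (𝓡 n) 𝓘(ℝ, ℝ) f' x := hf.mfderiv_eq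
  have h2 : (mfderiv (𝓡 n) 𝓘(ℝ, ℝ) g x : TangentSpace (𝓡 n) x →L[ℝ] ℝ)
    = mfderiv (𝓡 n) 𝓘(ℝ, ℝ) g' x := hg.mfderiv_eq
  rw [jacobiOp, jacobiOp, h1, h2, hf.self_of_nhds, hg.self_of_nhds, dirDeriv_congr hf,
    dirDeriv_congr hg]

end JacobiOp

/-! ### Rank one: the local Jacobi bracket -/

section RankOne

variable {n : ℕ} {M : Type*} [TopologicalSpace M] [T2Space M]
    [ChartedSpace (EuclideanSpace ℝ (Fin n)) M] [IsManifold (𝓡 n) ∞ M]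
    {F : Type*} [NormedAddCommGroup F] [NormedSpace ℝ F]
    {V : M → Type*} [TopologicalSpace (TotalSpace F V)]
    [∀ x, AddCommGroup (V x)] [∀ x, Module ℝ (V x)] [∀ x, TopologicalSpace (V x)]
    [FiberBundle F V] [VectorBundle ℝ F V]
    {br : Cₛ^∞⟮𝓡 n; F, V⟯ →ₗ[ℝ] Cₛ^∞⟮𝓡 n; F, V⟯ →ₗ[ℝ] Cₛ^∞⟮𝓡 n; F, V⟯}
    {a b : Cₛ^∞⟮𝓡 n; F, V⟯ → C^∞⟮𝓡 n, M; ℝ⟯ → C^∞⟮𝓡 n, M; ℝ⟯}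

omit [T2Space M] [IsManifold (𝓡 n) ∞ M] in
theorem eventually_section_ne_zero {s : Cₛ^∞⟮𝓡 n; F, V⟯} {p : M} (hs : s p ≠ 0) :
    ∀ᶠ y in 𝓝 p, s y ≠ 0 := by
  set e := trivializationAt F V p
  have hp : p ∈ e.baseSet := FiberBundle.mem_baseSet_trivializationAt F V p
  have hz {y : M} (hy : y ∈ e.baseSet) : (e ⟨y, s y⟩).2 = 0 ↔ s y = 0 :=
    (e.linearEquivAt ℝ y hy).map_eq_zero_iff
  have hc : ContinuousAt (fun y => (e ⟨y, s y⟩).2) p :=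
    (contMDiffAt_totalSpace.1 s.contMDiff.contMDiffAt).2.continuousAt
  filter_upwards [hc.eventually_ne (mt (hz hp).1 hs), e.open_baseSet.mem_nhds hp] with y hy hye
  exact mt (hz hye).2 hy

namespace IsBracketSymbol

/-- The structure functions of a skew-symmetric bracket with respect to a section `e`: the bracket
of `f e` and `g e` is `localBracket f g` times `e`. -/
def localBracket (a : Cₛ^∞⟮𝓡 n; F, V⟯ → C^∞⟮𝓡 n, M; ℝ⟯ → C^∞⟮𝓡 n, M; ℝ⟯) (e : Cₛ^∞⟮𝓡 n; F, V⟯)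
    (f g : C^∞⟮𝓡 n, M; ℝ⟯) : C^∞⟮𝓡 n, M; ℝ⟯ :=
  f * a e g - a (g • e) f

variable [ContMDiffVectorBundle ∞ F V (𝓡 n)]

theorem bracket_smul_smul [Nontrivial F] (h : IsBracketSymbol br a b) (hjac : SatisfiesJacobi br)
    {e : Cₛ^∞⟮𝓡 n; F, V⟯} (he : br e e = 0) (f g : C^∞⟮𝓡 n, M; ℝ⟯) :
    br (f • e) (g • e) = localBracket a e f g • e := by
  rw [h.left, h.right, he, localBracket]
  linear_combination (norm := module) (h.add_eq_zero hjac (g • e) f) • e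

/-- The bivector field of a bracket, in the coordinates given by the functions `u`. -/
def bivector (a : Cₛ^∞⟮𝓡 n; F, V⟯ → C^∞⟮𝓡 n, M; ℝ⟯ → C^∞⟮𝓡 n, M; ℝ⟯) (e : Cₛ^∞⟮𝓡 n; F, V⟯)
    (p : M) (u : Fin n → C^∞⟮𝓡 n, M; ℝ⟯) : TwoTensorField (𝓡 n) M := fun y =>
  ∑ i, ∑ j, (a (u i • e) (u j) - u i * a e (u j)) y •
    tangentTensor (coordinateField p i y) (coordinateField p j y)

set_option synthInstance.maxHeartbeats 400000 in
set_option maxHeartbeats 1000000 in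
omit [T2Space M] [ContMDiffVectorBundle ∞ F V (𝓡 n)] in
theorem contMDiffAt_bivector (e : Cₛ^∞⟮𝓡 n; F, V⟯) {p y : M} (u : Fin n → C^∞⟮𝓡 n, M; ℝ⟯)
    (hy : y ∈ (chartAt (EuclideanSpace ℝ (Fin n)) p).source) :
    ContMDiffAt (𝓡 n) ((𝓡 n).prod 𝓘(ℝ, (EuclideanSpace ℝ (Fin n) →L[ℝ] ℝ) →L[ℝ]
        (EuclideanSpace ℝ (Fin n) →L[ℝ] ℝ) →L[ℝ] ℝ)) ∞
      (fun y => TotalSpace.mk' ((EuclideanSpace ℝ (Fin n) →L[ℝ] ℝ) →L[ℝ]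
        (EuclideanSpace ℝ (Fin n) →L[ℝ] ℝ) →L[ℝ] ℝ)
        (E := fun x : M => (TangentSpace (𝓡 n) x →L[ℝ] ℝ) →L[ℝ]
          (TangentSpace (𝓡 n) x →L[ℝ] ℝ) →L[ℝ] ℝ) y (bivector a e p u y)) y := by
  refine ContMDiffAt.sum_section fun i _ => ContMDiffAt.sum_section fun j _ => ?_
  exact ((a (u i • e) (u j) - u i * a e (u j)).contMDiff.contMDiffAt).smul_section
    (contMDiffAt_tangentTensor (contMDiffAt_coordinateField i hy)
      (contMDiffAt_coordinateField j hy))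

omit [T2Space M] [ContMDiffVectorBundle ∞ F V (𝓡 n)] in
theorem bivector_apply (e : Cₛ^∞⟮𝓡 n; F, V⟯) (p y : M) (u : Fin n → C^∞⟮𝓡 n, M; ℝ⟯)
    (α β : TangentSpace (𝓡 n) y →L[ℝ] ℝ) :
    bivector a e p u y α β = ∑ i, ∑ j, (a (u i • e) (u j) - u i * a e (u j)) y *
      (α (coordinateField p i y) * β (coordinateField p j y)) := by
  simp only [bivector, sum_apply, smul_apply,
    tangentTensor_apply, smul_eq_mul]

section

variable [Nontrivial F] (h : IsBracketSymbol br a b) (hjac : SatisfiesJacobi br)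
include h hjac

/-- The case `X = Y = e` of `smul_left_sub_smul`, with `b = -a`. Being a derivation in `g`, the
defect is then one in `f` as well. -/
theorem symbol_skew {e : Cₛ^∞⟮𝓡 n; F, V⟯} {y : M} (hy : e y ≠ 0) (f g : C^∞⟮𝓡 n, M; ℝ⟯) :
    (a (f • e) g - f * a e g) y = -(a (g • e) f - g * a e f) y := by
  have h1 := h.smul_left_sub_smul e e f g
  have hb (Y : Cₛ^∞⟮𝓡 n; F, V⟯) (f : C^∞⟮𝓡 n, M; ℝ⟯) : b Y f = -a Y f :=
    eq_neg_of_add_eq_zero_right (h.add_eq_zero hjac Y f)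
  rw [hb, hb, show -a (g • e) f - g * -a e f = -(a (g • e) f - g * a e f) by ring] at h1
  exact smul_left_injective ℝ hy (congrArg (fun Z : Cₛ^∞⟮𝓡 n; F, V⟯ => Z y) h1)

/-- The defect is the derivative of `g` along a tangent vector, so it expands in coordinates;
skewness transfers this expansion to `f`. -/
theorem bivector_mfderiv {e : Cₛ^∞⟮𝓡 n; F, V⟯} {p y : M} {u : Fin n → C^∞⟮𝓡 n, M; ℝ⟯}
    (hey : e y ≠ 0) (hy : y ∈ (chartAt (EuclideanSpace ℝ (Fin n)) p).source)
    (hu : ∀ i, u i =ᶠ[𝓝 y] fun z => extChartAt (𝓡 n) p z i) (f g : C^∞⟮𝓡 n, M; ℝ⟯) :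
    bivector a e p u y (mfderiv (𝓡 n) 𝓘(ℝ, ℝ) f y : TangentSpace (𝓡 n) y →L[ℝ] ℝ)
      (mfderiv (𝓡 n) 𝓘(ℝ, ℝ) g y : TangentSpace (𝓡 n) y →L[ℝ] ℝ)
      = (a (f • e) g - f * a e g) y := by
  have key (f g : C^∞⟮𝓡 n, M; ℝ⟯) : (a (f • e) g - f * a e g) y
      = ∑ j, (a (f • e) (u j) - f * a e (u j)) y * dirDeriv g y (coordinateField p j y) := by
    have h1 (g : C^∞⟮𝓡 n, M; ℝ⟯) : (a (f • e) g - f * a e g) y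
        = dirDeriv g y (h.vectorField (f • e) y + (-f y) • h.vectorField e y) := by
      rw [dirDeriv_add, dirDeriv_smul, h.dirDeriv_vectorField, h.dirDeriv_vectorField]
      show a (f • e) g y - f y * a e g y = _
      ring
    have h2 := sum_dirDeriv_smul_coordinateField hy hu
      (h.vectorField (f • e) y + (-f y) • h.vectorField e y)
    rw [h1 g, h2]
    simp only [← h1]
    refine (map_sum (mfderiv (𝓡 n) 𝓘(ℝ, ℝ) g y : TangentSpace (𝓡 n) y →L[ℝ] ℝ) _ _).trans ?_
    exact Finset.sum_congr rfl fun j _ => dirDeriv_smul _ _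
  refine (bivector_apply e p y u _ _).trans ?_
  rw [key f g, Finset.sum_comm]
  refine Finset.sum_congr rfl fun j _ => ?_
  rw [h.symbol_skew hjac hey, key (u j) f, ← Finset.sum_neg_distrib, Finset.sum_mul]
  refine Finset.sum_congr rfl fun i _ => ?_
  rw [h.symbol_skew hjac hey (u i) (u j)]
  exact (by intros; ring : ∀ c s t : ℝ, -c * (s * t) = -(c * s) * t) _ _ _

theorem bivector_self {e : Cₛ^∞⟮𝓡 n; F, V⟯} {p y : M} {u : Fin n → C^∞⟮𝓡 n, M; ℝ⟯}
    (hey : e y ≠ 0) (α : TangentSpace (𝓡 n) y →L[ℝ] ℝ) : bivector a e p u y α α = 0 := by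
  have h1 : bivector a e p u y α α = -bivector a e p u y α α := by
    conv_rhs => rw [bivector_apply, Finset.sum_comm, ← Finset.sum_neg_distrib]
    rw [bivector_apply]
    refine Finset.sum_congr rfl fun i _ => ?_
    rw [← Finset.sum_neg_distrib]
    refine Finset.sum_congr rfl fun j _ => ?_
    rw [h.symbol_skew hjac hey (u i) (u j)]
    ring
  linarith

theorem jacobiOp_eq_localBracket {e : Cₛ^∞⟮𝓡 n; F, V⟯} {p y : M} {u : Fin n → C^∞⟮𝓡 n, M; ℝ⟯}
    (hey : e y ≠ 0) (hy : y ∈ (chartAt (EuclideanSpace ℝ (Fin n)) p).source)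
    (hu : ∀ i, u i =ᶠ[𝓝 y] fun z => extChartAt (𝓡 n) p z i) (f g : C^∞⟮𝓡 n, M; ℝ⟯) :
    jacobiOp (bivector a e p u) (h.vectorField e) f g y = localBracket a e f g y := by
  rw [jacobiOp, h.bivector_mfderiv hjac hey hy hu, h.dirDeriv_vectorField, h.dirDeriv_vectorField,
    h.symbol_skew hjac hey]
  show -(a (g • e) f y - g y * a e f y) + f y * a e g y - g y * a e f y
    = f y * a e g y - a (g • e) f y
  ring

end

/-- In rank one a bracket satisfying the Jacobi identity is locally a Jacobi bracket. -/
theorem isLocallyJacobi (h : IsBracketSymbol br a b) (hjac : SatisfiesJacobi br)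
    (hF : Module.finrank ℝ F = 1) : IsLocallyJacobi br := by
  have : Nontrivial F := Module.nontrivial_of_finrank_pos (R := ℝ) (by omega)
  intro p
  have : Nontrivial (V p) :=
    Module.nontrivial_of_finrank_pos (R := ℝ) (by rw [finrank_fiber (F := F)]; omega)
  obtain ⟨v, hv⟩ := exists_ne (0 : V p)
  obtain ⟨e, rfl⟩ := exists_section_apply_eq (n := n) (F := F) p v
  have hee : br e e = 0 := (isLocalLieAlgebra_of_finrank_eq_one h hjac hF).alternating e
  obtain ⟨u, hu⟩ := exists_smooth_coordinates (n := n) (mem_chart_source _ p)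
  -- On `U`, `e` does not vanish, the chart is defined, and the global `u i` have the germs of the
  -- coordinates.
  obtain ⟨U, hU, hUo, hpU⟩ := eventually_nhds_iff.1 ((eventually_section_ne_zero hv).and
    ((Filter.eventually_mem_set.2 (chart_source_mem_nhds (EuclideanSpace ℝ (Fin n)) p)).and
      (Filter.eventually_all.2 fun i => (hu i).eventuallyEq_nhds)))
  have hop {f g : M → ℝ} {f' g' : C^∞⟮𝓡 n, M; ℝ⟯} {x : M} (hx : x ∈ U) (hf : f =ᶠ[𝓝 x] f')
      (hg : g =ᶠ[𝓝 x] g') :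
      jacobiOp (bivector a e p u) (h.vectorField e) f g x = localBracket a e f' g' x := by
    rw [jacobiOp_congr hf hg]
    exact h.jacobiOp_eq_localBracket hjac (hU x hx).1 (hU x hx).2.1 (hU x hx).2.2 f' g'
  -- Equality of germs, since the outer operation differentiates the inner one in the Jacobi
  -- identity.
  have hop' {f g : M → ℝ} {f' g' : C^∞⟮𝓡 n, M; ℝ⟯} {x : M} (hx : x ∈ U) (hf : f =ᶠ[𝓝 x] f')
      (hg : g =ᶠ[𝓝 x] g') :
      jacobiOp (bivector a e p u) (h.vectorField e) f g =ᶠ[𝓝 x] localBracket a e f' g' := by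
    filter_upwards [hf.eventuallyEq_nhds, hg.eventuallyEq_nhds, hUo.mem_nhds hx] with y h1 h2 h3
    exact hop h3 h1 h2
  refine ⟨U, e, bivector a e p u, h.vectorField e, hUo, hpU, e.contMDiff.contMDiffOn,
    fun x hx => (hU x hx).1,
    ⟨fun x hx => (contMDiffAt_bivector e u (hU x hx).2.1).contMDiffWithinAt,
      fun x hx α => h.bivector_self hjac (hU x hx).1 α,
      (h.vectorField e).contMDiff.contMDiffOn, fun f g k hf hg hk x hx => ?_⟩,
    fun X Y f g hf hg hX hY x hx => ?_⟩
  · obtain ⟨f', hf'⟩ := exists_smooth_eventuallyEq (n := n) hUo hx hf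
    obtain ⟨g', hg'⟩ := exists_smooth_eventuallyEq (n := n) hUo hx hg
    obtain ⟨k', hk'⟩ := exists_smooth_eventuallyEq (n := n) hUo hx hk
    rw [hop hx (hop' hx hf'.symm hg'.symm) hk'.symm, hop hx hf'.symm (hop' hx hg'.symm hk'.symm),
      hop hx hg'.symm (hop' hx hf'.symm hk'.symm)]
    -- Cancelling `e` in the Jacobi identity of the given bracket yields that of the functions.
    have h1 := hjac (f' • e) (g' • e) (k' • e)
    simp only [h.bracket_smul_smul hjac hee, ← sub_smul] at h1
    exact smul_left_injective ℝ (hU x hx).1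
      (congrArg (fun Z : Cₛ^∞⟮𝓡 n; F, V⟯ => Z x) h1)
  · obtain ⟨f', hf'⟩ := exists_smooth_eventuallyEq (n := n) hUo hx hf
    obtain ⟨g', hg'⟩ := exists_smooth_eventuallyEq (n := n) hUo hx hg
    have hX' : ∀ᶠ y in 𝓝 x, X y = (f' • e) y := by
      filter_upwards [hf', hUo.mem_nhds hx] with y hy hyU
      rw [hX y hyU, smoothSection_smul_apply, hy]
    have hY' : ∀ᶠ y in 𝓝 x, Y y = (g' • e) y := by
      filter_upwards [hg', hUo.mem_nhds hx] with y hy hyU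
      rw [hY y hyU, smoothSection_smul_apply, hy]
    rw [h.left_eq_of_eventuallyEq hX' Y, h.right_eq_of_eventuallyEq _ hY',
      h.bracket_smul_smul hjac hee, hop hx hf'.symm hg'.symm]
    rfl

end IsBracketSymbol

end RankOne

end

theorem theorem6 {n : ℕ} {M : Type*} [TopologicalSpace M] [T2Space M]
    [ChartedSpace (EuclideanSpace ℝ (Fin n)) M] [IsManifold (𝓡 n) ∞ M]
    {F : Type*} [NormedAddCommGroup F] [NormedSpace ℝ F] [FiniteDimensional ℝ F]
    {V : M → Type*} [TopologicalSpace (TotalSpace F V)]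
    [∀ x, AddCommGroup (V x)] [∀ x, Module ℝ (V x)] [∀ x, TopologicalSpace (V x)]
    [FiberBundle F V] [VectorBundle ℝ F V] [ContMDiffVectorBundle ∞ F V (𝓡 n)]
    (br : Cₛ^∞⟮𝓡 n; F, V⟯ →ₗ[ℝ] Cₛ^∞⟮𝓡 n; F, V⟯ →ₗ[ℝ] Cₛ^∞⟮𝓡 n; F, V⟯)
    (hjac : SatisfiesJacobi br)
    (hright : ∀ X, IsQuasiDerivation ℝ C^∞⟮𝓡 n, M; ℝ⟯ (br X))
    (hleft : ∀ Y, IsQuasiDerivation ℝ C^∞⟮𝓡 n, M; ℝ⟯ (br.flip Y)) :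
    (1 < Module.finrank ℝ F →
      ∃ a : AnchorMorphism (𝓡 n) F V,
        (∀ (X Y : Cₛ^∞⟮𝓡 n; F, V⟯) (x : M),
          a.toFun x (br X Y x) =
            VectorField.mlieBracket (𝓡 n)
              (fun y => a.toFun y (X y)) (fun y => a.toFun y (Y y)) x) ∧
        (∀ (X Y : Cₛ^∞⟮𝓡 n; F, V⟯) (f g : C^∞⟮𝓡 n, M; ℝ⟯) (x : M),
          br (f • X) (g • Y) x =
            (f x * g x) • br X Y x
              + (f x * dirDeriv g x (a.toFun x (X x))) • Y x
              - (g x * dirDeriv f x (a.toFun x (Y x))) • X x) ∧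
        (∀ (X Y : Cₛ^∞⟮𝓡 n; F, V⟯) (p : M), a.toFun p ≠ 0 → br X Y p = -(br Y X p))) ∧
    (Module.finrank ℝ F = 1 →
      (∀ X Y, br X Y = -(br Y X)) ∧ IsLocalLieAlgebra br ∧ IsLocallyJacobi br) := by
  refine ⟨exists_anchor_of_one_lt_finrank hjac hright hleft, fun hF => ?_⟩
  have : Nontrivial F := Module.nontrivial_of_finrank_pos (R := ℝ) (by omega)
  obtain ⟨a, b, h⟩ := IsBracketSymbol.exists_of_isQuasiDerivation hright hleft
  exact ⟨h.skew_of_finrank_eq_one hjac hF, isLocalLieAlgebra_of_finrank_eq_one h hjac hF,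
    h.isLocallyJacobi hjac hF⟩
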